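/- **Setting.** Let $k\ge 0$ and let $\Pi$ be a finite collection of $k$-ary predicates $P\colon\{0,1\}^k\to\{0,1\}$ (a boolean CSP). A $\Pi$-instance $\Im$ on $n$ variables is a nonempty finite list of constraints $P_1,\dots,P_M$ on $\{0,1\}^n$ (repetitions allowed), each of the form $x\mapsto P(x_{i_1},\dots,x_{i_k})$ with $P\in\Pi$ and distinct indices $i_1,\dots,i_k\in\{1,\dots,n\}$. Put $\Im(x)=\frac1M\sum_{j=1}^M P_j(x)$ and $\mathrm{opt}(\Im)=\max_{x\in\{0,1\}^n}\Im(x)$, and let $\Pi_n$ be the set of instances on $n$ variables. For a linear subspace $U\subseteq\mathbb R^{\{0,1\}^n}$ and $f\colon\{0,1\}^n\to\mathbb R$, let $\overline{\mathrm{sos}}_U(f)$ be the smallest $a\in\mathbb R$ such that $a-f=g_1^2+\dots+g_t^2$ on $\{0,1\}^n$ for some $t\in\mathbb N$ and $g_1,\dots,g_t\in U$ (and $+\infty$ if there is no such $a$). For $c,s\in\mathbb R$, the subspace $U$ *achieves a $(c,s)$-approximation for $\Pi_n$* if every $\Im\in\Pi_n$ with $\mathrm{opt}(\Im)\le s$ satisfies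 $\overline{\mathrm{sos}}_U(\Im)\le c$. *Degree-$d$ sum-of-squares* on $n$-variable instances is the case in which $U$ is the space of functions $g\colon\{0,1\}^n\to\mathbb R$ of degree (as multilinear polynomials) at most $d/2$. An *SDP relaxation of size $r$ for $\Pi_n$* consists of matrices $\tilde\Im\in\mathbb R^{r\times r}$ for $\Im\in\Pi_n$, matrices $\tilde x\in\mathbb R^{r\times r}$ for $x\in\{0,1\}^n$, and an affine subspace $L\subseteq\mathbb R^{r\times r}$, such that $\langle\tilde\Im,\tilde x\rangle=\Im(x)$ for all $\Im$ and $x$, and $\tilde x\in\mathcal S$ for all $x$, where $\mathcal S$ is the set of symmetric positive semidefinite matrices in $L$ and $\langle A,B\rangle=\mathrm{Tr}(A^{T}B)$. It *achieves a $(c,s)$-approximation for $\Pi_n$* if $\sup_{y\in\mathcal S}\langle\tilde\Im,y\rangle\le c$ for every $\Im\in\Pi_n$ with $\mathrm{opt}(\Im)\le s$. **Theorem.** Let $\Pi$ be a boolean CSP, $m\in\mathbb N$ and $c,s\in\mathbb R$. There is a number $\alpha=\alpha(\Pi,m,c,s)>0$ such that the following holds for every $d\in\mathbb N$. If degree-$d$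 sum-of-squares fails to achieve a $(c,s)$-approximation for $\Pi_m$, then for every $n\ge\max(m,2)$: 1. every linear subspace $U$ of functions $\{0,1\}^n\to\mathbb R$ with $\dim U\le\alpha\,(n/\log n)^{d/4}$ fails to achieve a $(c,s)$-approximation for $\Pi_n$; 2. every SDP relaxation for $\Pi_n$ of size at most $\alpha\,(n/\log n)^{d/4}$ fails to achieve a $(c,s)$-approximation for $\Pi_n$. -/

import Mathlib

/-! ### Functions on the discrete cube and their degree -/

/-- The discrete cube `{0,1}^n`. -/
abbrev Cube (n : ℕ) : Type := Fin n → Bool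

/-- The character `χ_S(x) = ∏_{i ∈ S} (2 x_i - 1)`. -/
noncomputable def cubeChar {n : ℕ} (S : Finset (Fin n)) (x : Cube n) : ℝ :=
  ∏ i ∈ S, (if x i then (1 : ℝ) else -1)

/-- The Fourier coefficient of `f` at `S`, for the uniform measure on the cube. -/
noncomputable def fourierCoefficient {n : ℕ} (f : Cube n → ℝ) (S : Finset (Fin n)) : ℝ :=
  (∑ x, f x * cubeChar S x) / (2 : ℝ) ^ n

open Classical in
/-- The degree `max {|S| : f̂(S) ≠ 0}` of a function on the cube (`0` for the zero function); it is
the degree of the unique multilinear polynomial that agrees with `f` on the cube. -/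
noncomputable def cubeDegree {n : ℕ} (f : Cube n → ℝ) : ℕ :=
  (Finset.univ.filter fun S : Finset (Fin n) => fourierCoefficient f S ≠ 0).sup Finset.card

theorem cubeDegree_le_iff {n : ℕ} (f : Cube n → ℝ) (t : ℕ) :
    cubeDegree f ≤ t ↔ ∀ S : Finset (Fin n), t < S.card → fourierCoefficient f S = 0 := by
  classical
  unfold cubeDegree
  rw [Finset.sup_le_iff]
  constructor
  · intro h S hS
    by_contra hne
    exact absurd (h S (by simp [hne])) (not_le.mpr hS)
  · intro h S hS
    by_contra hlt
    exact (Finset.mem_filter.mp hS).2 (h S (not_le.mp hlt))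

/-- The subspace of the functions `g` with `deg g ≤ d / 2`, whose squares generate the degree-`d`
sum-of-squares certificates. -/
noncomputable def sosSubspace (n d : ℕ) : Submodule ℝ (Cube n → ℝ) where
  carrier := {g | 2 * cubeDegree g ≤ d}
  zero_mem' := by
    have h : cubeDegree (0 : Cube n → ℝ) ≤ 0 :=
      (cubeDegree_le_iff _ _).mpr fun S _ => by simp [fourierCoefficient]
    simp only [Set.mem_ofPred_eq]
    omega
  add_mem' := by
    intro f g hf hg
    simp only [Set.mem_ofPred_eq] at hf hg ⊢
    have h : cubeDegree (f + g) ≤ d / 2 := by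
      have hf' := (cubeDegree_le_iff f (d / 2)).mp (by omega)
      have hg' := (cubeDegree_le_iff g (d / 2)).mp (by omega)
      refine (cubeDegree_le_iff _ _).mpr fun S hS => ?_
      have h1 := hf' S hS
      have h2 := hg' S hS
      unfold fourierCoefficient at h1 h2 ⊢
      simp only [Pi.add_apply, add_mul, Finset.sum_add_distrib, add_div, h1, h2, add_zero]
    omega
  smul_mem' := by
    intro a f hf
    simp only [Set.mem_ofPred_eq] at hf ⊢
    have h : cubeDegree (a • f) ≤ d / 2 := by
      have hf' := (cubeDegree_le_iff f (d / 2)).mp (by omega)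
      refine (cubeDegree_le_iff _ _).mpr fun S hS => ?_
      have h1 := hf' S hS
      unfold fourierCoefficient at h1 ⊢
      simp only [Pi.smul_apply, smul_eq_mul, mul_assoc, ← Finset.mul_sum, mul_div_assoc, h1,
        mul_zero]
    omega

/-! ### Sum-of-squares upper bounds -/

/-- `f = g_1² + ⋯ + g_t²` on the cube, for some `t ∈ ℕ` and `g_1, …, g_t ∈ U`. -/
def IsSumSqOf {n : ℕ} (U : Submodule ℝ (Cube n → ℝ)) (f : Cube n → ℝ) : Prop :=
  ∃ (t : ℕ) (g : Fin t → Cube n → ℝ), (∀ j, g j ∈ U) ∧ ∀ x, f x = ∑ j, g j x ^ 2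

/-- The subspace-`U` sum-of-squares upper bound for `f`: the smallest real `a` such that `a - f` is
a sum of squares of functions from `U`, and `⊤` if there is no such `a`. -/
noncomputable def sosUpperBound {n : ℕ} (U : Submodule ℝ (Cube n → ℝ)) (f : Cube n → ℝ) : EReal :=
  sInf {b : EReal | ∃ a : ℝ, b = (a : EReal) ∧ IsSumSqOf U fun x => a - f x}

/-! ### Boolean constraint satisfaction problems -/

/-- A constraint `P(X_{i_1}, …, X_{i_k})` on `n` variables, with `P` in the given collection of
`k`-ary predicates and `i_1, …, i_k` distinct. -/
structure CSPConstraint {k : ℕ} (Preds : Finset ((Fin k → Bool) → Bool)) (n : ℕ) where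
  pred : (Fin k → Bool) → Bool
  pred_mem : pred ∈ Preds
  index : Fin k ↪ Fin n

/-- An instance on `n` variables: a nonempty finite family of constraints (repetition allowed). -/
structure CSPInstance {k : ℕ} (Preds : Finset ((Fin k → Bool) → Bool)) (n : ℕ) where
  size : ℕ
  size_pos : 0 < size
  constraint : Fin size → CSPConstraint Preds n

namespace CSPInstance

variable {k : ℕ} {Preds : Finset ((Fin k → Bool) → Bool)} {n : ℕ}

/-- The fraction of the constraints that the assignment `x` satisfies. -/
noncomputable def value (I : CSPInstance Preds n) (x : Cube n) : ℝ :=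
  (∑ j, if (I.constraint j).pred (fun i => x ((I.constraint j).index i)) then (1 : ℝ) else 0)
    / (I.size : ℝ)

/-- The optimal value `max_x I(x)`. -/
noncomputable def opt (I : CSPInstance Preds n) : ℝ :=
  Finset.univ.sup' Finset.univ_nonempty I.value

end CSPInstance

/-- The subspace `U` achieves a `(c,s)`-approximation on `n`-variable instances: every instance
with `opt ≤ s` has subspace-`U` sum-of-squares upper bound at most `c`. -/
def SubspaceAchieves {k : ℕ} (Preds : Finset ((Fin k → Bool) → Bool)) {n : ℕ}
    (U : Submodule ℝ (Cube n → ℝ)) (c s : ℝ) : Prop :=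
  ∀ I : CSPInstance Preds n, I.opt ≤ s → sosUpperBound U I.value ≤ (c : EReal)

/-! ### Semidefinite programming relaxations -/

/-- The entrywise inner product `Tr(Aᵀ B)` on `r × r` matrices. -/
def matrixInner {r : ℕ} (A B : Matrix (Fin r) (Fin r) ℝ) : ℝ :=
  (A.transpose * B).trace

/-- An SDP relaxation of size `r` for the `n`-variable instances: a linearization of instances and
assignments by `r × r` matrices, and a spectrahedron, independent of the instance, that contains
all linearized assignments. -/
structure SDPRelaxation {k : ℕ} (Preds : Finset ((Fin k → Bool) → Bool)) (n r : ℕ) where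
  linInstance : CSPInstance Preds n → Matrix (Fin r) (Fin r) ℝ
  linPoint : Cube n → Matrix (Fin r) (Fin r) ℝ
  inner_eq : ∀ (I : CSPInstance Preds n) (x : Cube n),
    matrixInner (linInstance I) (linPoint x) = I.value x
  affine : AffineSubspace ℝ (Matrix (Fin r) (Fin r) ℝ)
  point_affine : ∀ x, linPoint x ∈ affine
  point_psd : ∀ x, (linPoint x).PosSemidef

namespace SDPRelaxation

variable {k : ℕ} {Preds : Finset ((Fin k → Bool) → Bool)} {n r : ℕ}

/-- The feasible region: the psd matrices in the affine subspace. -/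
def feasible (R : SDPRelaxation Preds n r) : Set (Matrix (Fin r) (Fin r) ℝ) :=
  {Y | Y ∈ R.affine ∧ Y.PosSemidef}

/-- The value of the relaxation on an instance: the supremum (possibly `⊤`) of the linearized
objective over the feasible region. -/
noncomputable def value (R : SDPRelaxation Preds n r) (I : CSPInstance Preds n) : EReal :=
  ⨆ Y ∈ R.feasible, (matrixInner (R.linInstance I) Y : EReal)

/-- The relaxation achieves a `(c,s)`-approximation: every instance with `opt ≤ s` has relaxation
value at most `c`. -/
def Achieves (R : SDPRelaxation Preds n r) (c s : ℝ) : Prop :=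
  ∀ I : CSPInstance Preds n, I.opt ≤ s → R.value I ≤ (c : EReal)

end SDPRelaxation

/-! ### Fourier analysis on the cube -/

/-! Failure of degree-d sum-of-squares provides an instance `I` on m variables and, by separation, a
function `D` on the small cube with ∑ D g² ≥ 0 whenever deg g ≤ d/2, but ∑ D (c - I) < 0
(`exists_pseudoDensity`). A successful subspace or SDP relaxation gives psd r × r matrices with c -
I(x_σ) ≈ b_σ + Tr(P_σ Q(x)) and b_σ ≥ 0, for every placement σ of the m variables among the n
(`SubspaceAchieves.exists_approxFactors`, `SDPRelaxation.Achieves.approxFactors`). Weighting this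
with D(x_σ) and averaging over x and over random σ, each variable being drawn from its own block of
N ≈ n/m variables, makes the average of D(x_σ) Tr(P_σ Q(x)) at most a negative constant. For small r
this is impossible, for the following reason.

Suppose first that Q(x) = R(x)² with entries of R of degree at most a. A random σ meets a fixed set
of at most a variables in more than d/2 points with probability O((a/N)^(⌊d/2⌋+1)), so up to a small
part R has degree at most d/2 in the variables x_σ, and the average is almost nonnegative
(`sum_trace_mul_sq_ge`).

A general Q is reduced to this case by spectral amplification. Put T(x) = ∑_σ D(x_σ) P_σ, whose
entries have degree at most m. If ∑ Tr(T Q) is very negative, then T has very negative eigenvalues,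
and R = (B - T)^k favours them so strongly that ∑ Tr(T R²) < -δ ∑ Tr(R²) as soon as k is of order 1
+ log r (`Matrix.trace_mul_pow_le`, `sum_trace_mul_gt`). Here a = km. The comparison needs ∑ P_σ ≤ 1
and P_σ ≤ O(r)/N^m, which two changes of basis achieve (`Matrix.exists_whitened_factorization`). The
contradiction arises once r (km/N)^(⌊d/2⌋+1) is small, which r ≤ α (n/log n)^(d/4) ensures.

The constant does not depend on d because only d ≤ 2m needs this argument: beyond that every
function is allowed in a certificate, and failure means that c - I takes a negative value
(`CSPInstance.not_approxFactors_of_lt`). -/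

theorem cubeChar_mul_self {n : ℕ} (S : Finset (Fin n)) (x : Cube n) :
    cubeChar S x * cubeChar S x = 1 := by
  unfold cubeChar
  rw [← Finset.prod_mul_distrib]
  exact Finset.prod_eq_one fun i _ => by split_ifs <;> norm_num

theorem sum_prod_cube {n : ℕ} (φ : Fin n → Bool → ℝ) :
    ∑ x : Cube n, ∏ i, φ i (x i) = ∏ i, ∑ b, φ i b := by
  rw [Finset.prod_univ_sum, Fintype.piFinset_univ]

theorem cubeChar_eq_prod_univ {n : ℕ} (S : Finset (Fin n)) (x : Cube n) :
    cubeChar S x = ∏ i, if i ∈ S then (if x i then (1 : ℝ) else -1) else 1 := by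
  unfold cubeChar
  rw [Finset.prod_ite_mem, Finset.univ_inter]

theorem cubeChar_mul_cubeChar {n : ℕ} (S T : Finset (Fin n)) (x : Cube n) :
    cubeChar S x * cubeChar T x = cubeChar (symmDiff S T) x := by
  simp only [cubeChar_eq_prod_univ, ← Finset.prod_mul_distrib, Finset.mem_symmDiff]
  refine Finset.prod_congr rfl fun i _ => ?_
  by_cases hS : i ∈ S <;> by_cases hT : i ∈ T <;> cases x i <;> simp [hS, hT]

theorem sum_cubeChar {n : ℕ} (S : Finset (Fin n)) :
    ∑ x, cubeChar S x = if S = ∅ then (2 : ℝ) ^ n else 0 := by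
  simp only [cubeChar_eq_prod_univ]
  rw [sum_prod_cube (fun i b => if i ∈ S then (if b then (1 : ℝ) else -1) else 1)]
  split_ifs with h
  · subst h
    simp
  · obtain ⟨i, hi⟩ := Finset.nonempty_iff_ne_empty.mpr h
    exact Finset.prod_eq_zero (Finset.mem_univ i) (by simp [hi])

theorem sum_cubeChar_mul_cubeChar {n : ℕ} (S T : Finset (Fin n)) :
    ∑ x, cubeChar S x * cubeChar T x = if S = T then (2 : ℝ) ^ n else 0 := by
  simp only [cubeChar_mul_cubeChar, sum_cubeChar]
  congr 1
  simp [← Finset.bot_eq_empty, symmDiff_eq_bot]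

theorem sum_cubeChar_dual {n : ℕ} (x y : Cube n) :
    ∑ S, cubeChar S x * cubeChar S y = if x = y then (2 : ℝ) ^ n else 0 := by
  unfold cubeChar
  simp only [← Finset.prod_mul_distrib]
  have h := Finset.prod_one_add (R := ℝ) (s := (Finset.univ : Finset (Fin n)))
    (f := fun i => (if x i then (1 : ℝ) else -1) * (if y i then (1 : ℝ) else -1))
  rw [Finset.powerset_univ] at h
  rw [← h]
  split_ifs with hxy
  · subst hxy
    have : ∀ i ∈ (Finset.univ : Finset (Fin n)),
        1 + (if x i then (1 : ℝ) else -1) * (if x i then (1 : ℝ) else -1) = 2 := by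
      intro i _
      split_ifs <;> norm_num
    rw [Finset.prod_congr rfl this]
    simp
  · obtain ⟨i, hi⟩ := Function.ne_iff.mp hxy
    refine Finset.prod_eq_zero (Finset.mem_univ i) ?_
    cases hx : x i <;> cases hy : y i <;> simp_all

theorem fourier_inversion {n : ℕ} (f : Cube n → ℝ) (x : Cube n) :
    f x = ∑ S, fourierCoefficient f S * cubeChar S x := by
  unfold fourierCoefficient
  have h : ∑ S, (∑ y, f y * cubeChar S y) / (2 : ℝ) ^ n * cubeChar S x
      = (∑ y, f y * ∑ S, cubeChar S y * cubeChar S x) / (2 : ℝ) ^ n := by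
    simp only [Finset.sum_div, Finset.sum_mul, Finset.mul_sum]
    rw [Finset.sum_comm]
    exact Finset.sum_congr rfl fun _ _ => Finset.sum_congr rfl fun _ _ => by ring
  rw [h]
  simp [sum_cubeChar_dual]

theorem fourierCoefficient_sum_cubeChar {n : ℕ} (s : Finset (Finset (Fin n)))
    (a : Finset (Fin n) → ℝ) (T : Finset (Fin n)) :
    fourierCoefficient (fun x => ∑ S ∈ s, a S * cubeChar S x) T = if T ∈ s then a T else 0 := by
  unfold fourierCoefficient
  simp only [Finset.sum_mul]
  rw [Finset.sum_comm]
  simp only [mul_assoc, ← Finset.mul_sum, sum_cubeChar_mul_cubeChar]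
  simp only [mul_ite, mul_zero, Finset.sum_ite_eq']
  split_ifs <;> simp

theorem fourierCoefficient_cubeChar {n : ℕ} (S T : Finset (Fin n)) :
    fourierCoefficient (cubeChar S) T = if T = S then 1 else 0 := by
  have h := fourierCoefficient_sum_cubeChar {S} (fun _ => 1) T
  simpa using h

/-- The part of `f` whose Fourier coefficients lie in `s`. -/
noncomputable def fourierProj {n : ℕ} (s : Finset (Finset (Fin n))) (f : Cube n → ℝ) :
    Cube n → ℝ :=
  fun x => ∑ S ∈ s, fourierCoefficient f S * cubeChar S x

theorem parseval {n : ℕ} (f : Cube n → ℝ) :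
    ∑ x, f x ^ 2 = (2 : ℝ) ^ n * ∑ S, fourierCoefficient f S ^ 2 := by
  have h : ∀ x, f x ^ 2 = ∑ S, fourierCoefficient f S * (f x * cubeChar S x) := by
    intro x
    rw [sq]
    nth_rewrite 2 [fourier_inversion f x]
    rw [Finset.mul_sum]
    exact Finset.sum_congr rfl fun _ _ => by ring
  simp only [h]
  rw [Finset.sum_comm, Finset.mul_sum]
  refine Finset.sum_congr rfl fun S _ => ?_
  rw [← Finset.mul_sum]
  have : ∑ x, f x * cubeChar S x = 2 ^ n * fourierCoefficient f S := by
    unfold fourierCoefficient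
    field_simp
  rw [this]
  ring

theorem parseval_fourierProj {n : ℕ} (s : Finset (Finset (Fin n))) (f : Cube n → ℝ) :
    ∑ x, fourierProj s f x ^ 2 = (2 : ℝ) ^ n * ∑ S ∈ s, fourierCoefficient f S ^ 2 := by
  rw [parseval]
  congr 1
  unfold fourierProj
  simp only [fourierCoefficient_sum_cubeChar, ite_pow, ne_eq, OfNat.ofNat_ne_zero,
    not_false_eq_true, zero_pow]
  rw [Finset.sum_ite_mem, Finset.univ_inter]

theorem fourierProj_add_compl {n : ℕ} (s : Finset (Finset (Fin n))) (f : Cube n → ℝ)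
    (x : Cube n) : fourierProj s f x + fourierProj sᶜ f x = f x := by
  unfold fourierProj
  rw [Finset.sum_add_sum_compl, ← fourier_inversion]

/-! ### Functions of bounded degree -/

theorem mem_sosSubspace_iff {n d : ℕ} {f : Cube n → ℝ} :
    f ∈ sosSubspace n d ↔ ∀ S : Finset (Fin n), d < 2 * S.card → fourierCoefficient f S = 0 := by
  have h : f ∈ sosSubspace n d ↔ cubeDegree f ≤ d / 2 := by
    change 2 * cubeDegree f ≤ d ↔ _
    omega
  rw [h, cubeDegree_le_iff]
  exact forall_congr' fun S => by rw [show d / 2 < S.card ↔ d < 2 * S.card by omega]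

theorem cubeChar_mem_sosSubspace {n d : ℕ} {S : Finset (Fin n)} (hS : 2 * S.card ≤ d) :
    cubeChar S ∈ sosSubspace n d := by
  rw [mem_sosSubspace_iff]
  intro T hT
  rw [fourierCoefficient_cubeChar, if_neg]
  rintro rfl
  omega

theorem sosSubspace_eq_span {n d : ℕ} :
    sosSubspace n d = Submodule.span ℝ {f | ∃ S : Finset (Fin n), 2 * S.card ≤ d ∧
      f = cubeChar S} := by
  apply le_antisymm
  · intro f hf
    have h : f = ∑ S, fourierCoefficient f S • cubeChar S := by
      ext x
      rw [fourier_inversion f x]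
      simp
    rw [h]
    refine Submodule.sum_mem _ fun S _ => ?_
    by_cases hS : 2 * S.card ≤ d
    · exact Submodule.smul_mem _ _ (Submodule.subset_span ⟨S, hS, rfl⟩)
    · rw [mem_sosSubspace_iff.mp hf S (by omega), zero_smul]
      exact Submodule.zero_mem _
  · rw [Submodule.span_le]
    rintro _ ⟨S, hS, rfl⟩
    exact cubeChar_mem_sosSubspace hS

theorem mul_mem_sosSubspace {n a b : ℕ} {f g : Cube n → ℝ} (hf : f ∈ sosSubspace n a)
    (hg : g ∈ sosSubspace n b) : f * g ∈ sosSubspace n (a + b) := by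
  rw [sosSubspace_eq_span] at hf hg
  have h := Submodule.mul_mem_mul hf hg
  rw [Submodule.span_mul_span] at h
  refine Submodule.span_le.mpr ?_ h
  rintro _ ⟨_, ⟨S, hS, rfl⟩, _, ⟨T, hT, rfl⟩, rfl⟩
  have : cubeChar S * cubeChar T = cubeChar (symmDiff S T) := by
    ext x
    exact cubeChar_mul_cubeChar S T x
  simp only [this]
  refine cubeChar_mem_sosSubspace ?_
  have h1 : (symmDiff S T).card ≤ (S ∪ T).card := Finset.card_le_card fun i hi => by
    rw [Finset.mem_symmDiff] at hi
    rw [Finset.mem_union]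
    tauto
  have h2 := Finset.card_union_le S T
  omega

theorem const_mem_sosSubspace {n d : ℕ} (a : ℝ) : (fun _ => a) ∈ sosSubspace n d := by
  have h : (fun _ => a) = a • (cubeChar ∅ : Cube n → ℝ) := by
    ext x
    simp [cubeChar]
  rw [h]
  exact Submodule.smul_mem _ _ (cubeChar_mem_sosSubspace (by simp))

theorem sosSubspace_eq_top {n d : ℕ} (h : 2 * n ≤ d) : sosSubspace n d = ⊤ := by
  refine eq_top_iff.mpr fun f _ => mem_sosSubspace_iff.mpr fun S hS => ?_
  have := Finset.card_le_univ S
  rw [Fintype.card_fin] at this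
  omega

/-! ### Restriction to embedded subcubes -/

theorem cubeChar_extend {m n : ℕ} (σ : Fin m ↪ Fin n) (A : Finset (Fin n)) (x : Cube n)
    (y : Cube m) :
    cubeChar A (Function.extend σ y x) =
      cubeChar (A.filter fun j => j ∉ Set.range σ) x *
        cubeChar (A.preimage σ σ.injective.injOn) y := by
  classical
  unfold cubeChar
  rw [← Finset.prod_filter_mul_prod_filter_not A (fun j => j ∉ Set.range σ)]
  congr 1
  · refine Finset.prod_congr rfl fun j hj => ?_
    rw [Function.extend_apply' _ _ _ (by simpa using (Finset.mem_filter.mp hj).2)]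
  · symm
    refine Finset.prod_bij (fun i _ => σ i) ?_ ?_ ?_ ?_
    · intro i hi
      simpa using hi
    · intro i _ j _ hij
      exact σ.injective hij
    · intro j hj
      rw [Finset.mem_filter, not_not] at hj
      obtain ⟨hj, i, rfl⟩ := hj
      exact ⟨i, by simpa using hj, rfl⟩
    · intro i _
      rw [σ.injective.extend_apply]

theorem cubeChar_comp {m n : ℕ} (σ : Fin m ↪ Fin n) (S : Finset (Fin m)) (x : Cube n) :
    cubeChar S (fun i => x (σ i)) = cubeChar (S.map σ) x := by
  simp [cubeChar]

theorem comp_mem_sosSubspace {m n d : ℕ} (σ : Fin m ↪ Fin n) {f : Cube m → ℝ}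
    (hf : f ∈ sosSubspace m d) : (fun x : Cube n => f fun i => x (σ i)) ∈ sosSubspace n d := by
  rw [sosSubspace_eq_span] at hf
  have h : Submodule.span ℝ {f | ∃ S : Finset (Fin m), 2 * S.card ≤ d ∧ f = cubeChar S} ≤
      (sosSubspace n d).comap (LinearMap.funLeft ℝ ℝ fun (x : Cube n) i => x (σ i)) := by
    rw [Submodule.span_le]
    rintro _ ⟨S, hS, rfl⟩
    have : LinearMap.funLeft ℝ ℝ (fun (x : Cube n) i => x (σ i)) (cubeChar S)
        = cubeChar (S.map σ) := by
      ext x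
      exact cubeChar_comp σ S x
    rw [SetLike.mem_coe, Submodule.mem_comap, this]
    exact cubeChar_mem_sosSubspace (by simpa using hS)
  exact h hf

/-- Resampling the coordinates in the range of `σ` preserves the uniform measure: exchanging them
with `y` is an involution on the pairs (x, y). -/
theorem sum_sum_extend {m n : ℕ} (σ : Fin m ↪ Fin n) (F : Cube n → ℝ) :
    ∑ x : Cube n, ∑ y : Cube m, F (Function.extend σ y x) = (2 : ℝ) ^ m * ∑ x, F x := by
  have h : ∀ p : Cube n × Cube m, Function.extend σ (fun i => p.1 (σ i))
      (Function.extend σ p.2 p.1) = p.1 := by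
    intro p
    ext j
    by_cases hj : ∃ i, σ i = j
    · obtain ⟨i, rfl⟩ := hj
      rw [σ.injective.extend_apply]
    · rw [Function.extend_apply' _ _ _ hj, Function.extend_apply' _ _ _ hj]
  let Φ : Cube n × Cube m → Cube n × Cube m :=
    fun p => (Function.extend σ p.2 p.1, fun i => p.1 (σ i))
  have hΦ : Function.Involutive Φ := by
    intro p
    exact Prod.ext (h p) (funext fun i => σ.injective.extend_apply p.2 p.1 i)
  rw [← Fintype.sum_prod_type' (f := fun x y => F (Function.extend σ y x))]
  rw [show (∑ p : Cube n × Cube m, F (Function.extend σ p.2 p.1)) = ∑ p, F (Φ p).1 from rfl]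
  have h2 := Equiv.sum_comp (hΦ.toPerm Φ) fun p : Cube n × Cube m => F p.1
  rw [Function.Involutive.coe_toPerm] at h2
  rw [h2, Fintype.sum_prod_type]
  simp [Finset.mul_sum]

theorem sum_comp_embedding {m n : ℕ} (σ : Fin m ↪ Fin n) (F : Cube m → ℝ) :
    (2 : ℝ) ^ m * ∑ x : Cube n, F (fun i => x (σ i)) = (2 : ℝ) ^ n * ∑ y, F y := by
  have h := sum_sum_extend σ fun x => F fun i => x (σ i)
  simp only [σ.injective.extend_apply] at h
  rw [← h]
  simp

/-- The functions spanned by characters that involve few of the variables in the range of `σ`. -/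
def lowSubspace {m n : ℕ} (σ : Fin m ↪ Fin n) (d : ℕ) : Submodule ℝ (Cube n → ℝ) :=
  Submodule.span ℝ {f | ∃ A : Finset (Fin n),
    2 * (A.preimage σ σ.injective.injOn).card ≤ d ∧ f = cubeChar A}

theorem extend_mem_sosSubspace {m n d : ℕ} (σ : Fin m ↪ Fin n) {f : Cube n → ℝ}
    (hf : f ∈ lowSubspace σ d) (x : Cube n) :
    (fun y : Cube m => f (Function.extend σ y x)) ∈ sosSubspace m d := by
  have h : lowSubspace σ d ≤
      (sosSubspace m d).comap (LinearMap.funLeft ℝ ℝ fun y : Cube m => Function.extend σ y x) := by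
    unfold lowSubspace
    rw [Submodule.span_le]
    rintro _ ⟨A, hA, rfl⟩
    have : LinearMap.funLeft ℝ ℝ (fun y : Cube m => Function.extend σ y x) (cubeChar A)
        = cubeChar (A.filter fun j => j ∉ Set.range σ) x •
          cubeChar (A.preimage σ σ.injective.injOn) := by
      ext y
      exact cubeChar_extend σ A x y
    rw [SetLike.mem_coe, Submodule.mem_comap, this]
    exact Submodule.smul_mem _ _ (cubeChar_mem_sosSubspace hA)
  exact h hf

/-- With the coordinates off the range of `σ` frozen, `f` becomes a function of degree at most d/2
on the small cube, where `hD` applies; then average over the frozen coordinates. -/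
theorem pseudoDensity_sq_nonneg {m n d : ℕ} {D : Cube m → ℝ}
    (hD : ∀ g ∈ sosSubspace m d, 0 ≤ ∑ y, D y * g y ^ 2) (σ : Fin m ↪ Fin n) {f : Cube n → ℝ}
    (hf : f ∈ lowSubspace σ d) : 0 ≤ ∑ x : Cube n, D (fun i => x (σ i)) * f x ^ 2 := by
  have h := sum_sum_extend σ fun x => D (fun i => x (σ i)) * f x ^ 2
  have h2 : 0 ≤ (2 : ℝ) ^ m * ∑ x : Cube n, D (fun i => x (σ i)) * f x ^ 2 := by
    rw [← h]
    refine Finset.sum_nonneg fun x _ => ?_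
    have := hD _ (extend_mem_sosSubspace σ hf x)
    simpa [σ.injective.extend_apply] using this
  exact nonneg_of_mul_nonneg_right h2 (by positivity)

/-! ### Random embedded subcubes -/

/-- The embedding that sends `i` to the element of the `i`-th block selected by `σ`. -/
def blockEmbedding {m N n : ℕ} (e : Fin m × Fin N ↪ Fin n) (σ : Fin m → Fin N) : Fin m ↪ Fin n where
  toFun i := e (i, σ i)
  inj' _ _ h := congrArg Prod.fst (e.injective h)

/-- The sets of variables that meet the range of `σ` in more than `d / 2` elements. -/
noncomputable def highSets {m n : ℕ} (σ : Fin m ↪ Fin n) (d : ℕ) : Finset (Finset (Fin n)) :=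
  Finset.univ.filter fun A => d < 2 * (A.preimage σ σ.injective.injOn).card

/-- The coordinates of σ are chosen independently, and for each index in `J` at most `a` of the `N`
choices land in `A`. -/
theorem card_blockEmbedding_subset {m N n : ℕ} (e : Fin m × Fin N ↪ Fin n) {a : ℕ}
    {A : Finset (Fin n)} (hA : A.card ≤ a) (J : Finset (Fin m)) :
    N ^ J.card * (Finset.univ.filter fun σ : Fin m → Fin N => ∀ i ∈ J, e (i, σ i) ∈ A).card
      ≤ a ^ J.card * N ^ m := by
  have hset : (Finset.univ.filter fun σ : Fin m → Fin N => ∀ i ∈ J, e (i, σ i) ∈ A)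
      = Fintype.piFinset fun i => Finset.univ.filter fun b => i ∈ J → e (i, b) ∈ A := by
    ext σ
    simp [Fintype.mem_piFinset]
  have hpow : ∀ b : ℕ, b ^ J.card = ∏ i : Fin m, if i ∈ J then b else 1 := by
    intro b
    rw [Finset.prod_ite_mem, Finset.univ_inter, Finset.prod_const]
  have hN : N ^ m = ∏ _i : Fin m, N := by simp
  rw [hset, Fintype.card_piFinset, hpow N, hpow a, hN, ← Finset.prod_mul_distrib,
    ← Finset.prod_mul_distrib]
  refine Finset.prod_le_prod' fun i _ => ?_
  by_cases hi : i ∈ J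
  · simp only [hi, if_true, forall_true_left]
    rw [mul_comm]
    refine Nat.mul_le_mul_right _ (le_trans ?_ hA)
    refine Finset.card_le_card_of_injOn (fun b => e (i, b)) ?_ ?_
    · intro b hb
      simpa using hb
    · intro b _ b' _ h
      exact congrArg Prod.snd (e.injective h)
  · simp [hi]

/-- Union bound over the sets of d/2 + 1 indices that are sent into `A`; there are at most 2^m of
them. -/
theorem card_mem_highSets {m N n : ℕ} (e : Fin m × Fin N ↪ Fin n) (d : ℕ) {a : ℕ}
    {A : Finset (Fin n)} (hA : A.card ≤ a) :
    N ^ (d / 2 + 1) * (Finset.univ.filter fun σ : Fin m → Fin N =>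
      A ∈ highSets (blockEmbedding e σ) d).card ≤ 2 ^ m * (a ^ (d / 2 + 1) * N ^ m) := by
  classical
  have hsub : (Finset.univ.filter fun σ : Fin m → Fin N => A ∈ highSets (blockEmbedding e σ) d)
      ⊆ (Finset.powersetCard (d / 2 + 1) (Finset.univ : Finset (Fin m))).biUnion fun J =>
        Finset.univ.filter fun σ : Fin m → Fin N => ∀ i ∈ J, e (i, σ i) ∈ A := by
    intro σ hσ
    simp only [highSets, Finset.mem_filter, Finset.mem_univ, true_and] at hσ
    obtain ⟨J, hJ, hcard⟩ := Finset.exists_subset_card_eq (n := d / 2 + 1)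
      (s := A.preimage (blockEmbedding e σ) (blockEmbedding e σ).injective.injOn) (by omega)
    rw [Finset.mem_biUnion]
    refine ⟨J, Finset.mem_powersetCard.mpr ⟨Finset.subset_univ _, hcard⟩, ?_⟩
    simp only [Finset.mem_filter, Finset.mem_univ, true_and]
    intro i hi
    have := hJ hi
    rwa [Finset.mem_preimage] at this
  calc _ ≤ N ^ (d / 2 + 1) * ∑ J ∈ Finset.powersetCard (d / 2 + 1) (Finset.univ : Finset (Fin m)),
        (Finset.univ.filter fun σ : Fin m → Fin N => ∀ i ∈ J, e (i, σ i) ∈ A).card :=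
        Nat.mul_le_mul_left _ ((Finset.card_le_card hsub).trans Finset.card_biUnion_le)
    _ = ∑ J ∈ Finset.powersetCard (d / 2 + 1) (Finset.univ : Finset (Fin m)),
        N ^ (d / 2 + 1) *
          (Finset.univ.filter fun σ : Fin m → Fin N => ∀ i ∈ J, e (i, σ i) ∈ A).card :=
        Finset.mul_sum _ _ _
    _ ≤ ∑ J ∈ Finset.powersetCard (d / 2 + 1) (Finset.univ : Finset (Fin m)),
        a ^ (d / 2 + 1) * N ^ m := by
        refine Finset.sum_le_sum fun J hJ => ?_
        have := card_blockEmbedding_subset e hA J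
        rwa [(Finset.mem_powersetCard.mp hJ).2] at this
    _ ≤ _ := by
        rw [Finset.sum_const, smul_eq_mul, Finset.card_powersetCard, Finset.card_univ,
          Fintype.card_fin]
        exact Nat.mul_le_mul_right _ (Nat.choose_le_two_pow _ _)

/-- By Parseval, each squared Fourier coefficient is counted once for every σ that makes its set
high, and only sets of size at most `a` occur. -/
theorem sum_fourierProj_highSets_le {m N n : ℕ} (e : Fin m × Fin N ↪ Fin n) (d : ℕ) {a : ℕ}
    {f : Cube n → ℝ} (hf : f ∈ sosSubspace n (2 * a)) :
    (N : ℝ) ^ (d / 2 + 1) * ∑ σ : Fin m → Fin N, ∑ x,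
        fourierProj (highSets (blockEmbedding e σ) d) f x ^ 2
      ≤ 2 ^ m * ((a : ℝ) ^ (d / 2 + 1) * (N : ℝ) ^ m) * ∑ x, f x ^ 2 := by
  classical
  simp only [parseval_fourierProj]
  rw [parseval, ← Finset.mul_sum]
  have h1 : ∑ σ : Fin m → Fin N, ∑ S ∈ highSets (blockEmbedding e σ) d, fourierCoefficient f S ^ 2
      = ∑ S, ((Finset.univ.filter fun σ : Fin m → Fin N =>
        S ∈ highSets (blockEmbedding e σ) d).card : ℝ) * fourierCoefficient f S ^ 2 := by
    have : ∀ σ : Fin m → Fin N, ∑ S ∈ highSets (blockEmbedding e σ) d, fourierCoefficient f S ^ 2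
        = ∑ S, if S ∈ highSets (blockEmbedding e σ) d then fourierCoefficient f S ^ 2 else 0 := by
      intro σ
      rw [Finset.sum_ite_mem, Finset.univ_inter]
    simp only [this]
    rw [Finset.sum_comm]
    refine Finset.sum_congr rfl fun S _ => ?_
    rw [← Finset.sum_filter, Finset.sum_const, nsmul_eq_mul]
  rw [h1]
  have h2 : (N : ℝ) ^ (d / 2 + 1) * ∑ S, ((Finset.univ.filter fun σ : Fin m → Fin N =>
        S ∈ highSets (blockEmbedding e σ) d).card : ℝ) * fourierCoefficient f S ^ 2
      ≤ 2 ^ m * ((a : ℝ) ^ (d / 2 + 1) * (N : ℝ) ^ m) * ∑ S, fourierCoefficient f S ^ 2 := by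
    rw [Finset.mul_sum, Finset.mul_sum]
    refine Finset.sum_le_sum fun S _ => ?_
    by_cases hS : S.card ≤ a
    · rw [← mul_assoc]
      refine mul_le_mul_of_nonneg_right ?_ (sq_nonneg _)
      exact_mod_cast card_mem_highSets e d hS
    · rw [mem_sosSubspace_iff.mp hf S (by omega)]
      simp
  calc _ = 2 ^ n * ((N : ℝ) ^ (d / 2 + 1) * ∑ S, ((Finset.univ.filter fun σ : Fin m → Fin N =>
        S ∈ highSets (blockEmbedding e σ) d).card : ℝ) * fourierCoefficient f S ^ 2) := by ring
    _ ≤ 2 ^ n * (2 ^ m * ((a : ℝ) ^ (d / 2 + 1) * (N : ℝ) ^ m) *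
        ∑ S, fourierCoefficient f S ^ 2) := mul_le_mul_of_nonneg_left h2 (by positivity)
    _ = _ := by ring

theorem fourierProj_compl_highSets_mem {m n : ℕ} (σ : Fin m ↪ Fin n) (d : ℕ) (f : Cube n → ℝ) :
    fourierProj (highSets σ d)ᶜ f ∈ lowSubspace σ d := by
  have h : fourierProj (highSets σ d)ᶜ f
      = ∑ S ∈ (highSets σ d)ᶜ, fourierCoefficient f S • cubeChar S := by
    ext x
    simp [fourierProj]
  rw [h]
  refine Submodule.sum_mem _ fun S hS => Submodule.smul_mem _ _ (Submodule.subset_span ⟨S, ?_, rfl⟩)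
  simpa [highSets] using hS

/-! ### Separation from convex cones and pseudo-densities -/

theorem exists_separating_weights {ι : Type*} [Fintype ι] {K : Set (ι → ℝ)} (h0 : 0 ∈ K)
    (hadd : ∀ p ∈ K, ∀ q ∈ K, p + q ∈ K) (hsmul : ∀ a : ℝ, 0 ≤ a → ∀ p ∈ K, a • p ∈ K)
    {p : ι → ℝ} (hp : p ∉ closure K) :
    ∃ μ : ι → ℝ, (∀ q ∈ K, 0 ≤ ∑ i, μ i * q i) ∧ ∑ i, μ i * p i < 0 := by
  classical
  have hconv : Convex ℝ K := fun x hx y hy a b ha hb _ =>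
    hadd _ (hsmul a ha x hx) _ (hsmul b hb y hy)
  obtain ⟨f, u, hf, hu⟩ := geometric_hahn_banach_closed_point hconv.closure isClosed_closure hp
  have hu0 : 0 < u := by simpa using hf 0 (subset_closure h0)
  have hform : ∀ q : ι → ℝ, f q = ∑ i, f (Pi.single i 1) * q i := by
    intro q
    have := LinearMap.pi_apply_eq_sum_univ (f : (ι → ℝ) →ₗ[ℝ] ℝ) q
    simp only [ContinuousLinearMap.coe_coe, smul_eq_mul] at this
    rw [this]
    refine Finset.sum_congr rfl fun i _ => ?_
    rw [mul_comm]
    congr 2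
    ext j
    simp [Pi.single_apply, eq_comm]
  refine ⟨fun i => -f (Pi.single i 1), fun q hq => ?_, ?_⟩
  · simp only [neg_mul, Finset.sum_neg_distrib, ← hform]
    -- A functional bounded above on a cone is nonpositive there: otherwise rescale `q` until `f`
    -- takes the value `u`, which the strict separation excludes.
    by_contra hneg
    have hpos : 0 < f q := by linarith
    have := hf _ (subset_closure (hsmul (u / f q) (by positivity) q hq))
    rw [map_smul, smul_eq_mul, div_mul_cancel₀ _ hpos.ne'] at this
    exact lt_irrefl _ this
  · simp only [neg_mul, Finset.sum_neg_distrib, ← hform]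
    linarith

/-! ### The convex cone of sums of squares. -/

theorem IsSumSqOf.add {n : ℕ} {U : Submodule ℝ (Cube n → ℝ)} {f g : Cube n → ℝ}
    (hf : IsSumSqOf U f) (hg : IsSumSqOf U g) : IsSumSqOf U (f + g) := by
  obtain ⟨t, a, ha, hfa⟩ := hf
  obtain ⟨s, b, hb, hgb⟩ := hg
  refine ⟨t + s, Fin.append a b, fun j => ?_, fun x => ?_⟩
  · refine Fin.addCases (fun i => ?_) (fun i => ?_) j
    · rw [Fin.append_left]
      exact ha i
    · rw [Fin.append_right]
      exact hb i
  · rw [Fin.sum_univ_add]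
    simp [hfa x, hgb x]

theorem IsSumSqOf.smul {n : ℕ} {U : Submodule ℝ (Cube n → ℝ)} {f : Cube n → ℝ}
    (hf : IsSumSqOf U f) {a : ℝ} (ha : 0 ≤ a) : IsSumSqOf U (a • f) := by
  obtain ⟨t, g, hg, hfg⟩ := hf
  refine ⟨t, fun j => Real.sqrt a • g j, fun j => U.smul_mem _ (hg j), fun x => ?_⟩
  simp [hfg x, mul_pow, Real.sq_sqrt ha, Finset.mul_sum]

theorem isSumSqOf_zero {n : ℕ} (U : Submodule ℝ (Cube n → ℝ)) : IsSumSqOf U 0 :=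
  ⟨0, Fin.elim0, fun j => j.elim0, fun x => by simp⟩

theorem isSumSqOf_sq {n : ℕ} {U : Submodule ℝ (Cube n → ℝ)} {g : Cube n → ℝ} (hg : g ∈ U) :
    IsSumSqOf U fun x => g x ^ 2 :=
  ⟨1, fun _ => g, fun _ => hg, fun x => by simp⟩

theorem isSumSqOf_sum {n : ℕ} {U : Submodule ℝ (Cube n → ℝ)} {ι : Type*} (s : Finset ι)
    (f : ι → Cube n → ℝ) (hf : ∀ i ∈ s, IsSumSqOf U (f i)) : IsSumSqOf U (∑ i ∈ s, f i) := by
  classical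
  induction s using Finset.induction_on with
  | empty => simpa using isSumSqOf_zero U
  | insert i s hi ih =>
    rw [Finset.sum_insert hi]
    exact (hf i (by simp)).add (ih fun j hj => hf j (by simp [hj]))

/-- For a sign b, 1 + b χ_S χ_T = (χ_S + b χ_T)²/2, since characters square to 1. -/
theorem isSumSqOf_one_add_smul_cubeChar {n d : ℕ} {S T : Finset (Fin n)} (hS : 2 * S.card ≤ d)
    (hT : 2 * T.card ≤ d) {a : ℝ} :
    IsSumSqOf (sosSubspace n d) fun x => |a| + a * cubeChar (symmDiff S T) x := by
  have key : ∀ b : ℝ, b ^ 2 = 1 → IsSumSqOf (sosSubspace n d)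
      fun x => 1 + b * cubeChar (symmDiff S T) x := by
    intro b hb
    have h := isSumSqOf_sq ((sosSubspace n d).add_mem (cubeChar_mem_sosSubspace hS)
      ((sosSubspace n d).smul_mem b (cubeChar_mem_sosSubspace hT)))
    convert h.smul (a := 1 / 2) (by norm_num) using 1
    ext x
    have h1 := cubeChar_mul_self S x
    have h2 := cubeChar_mul_self T x
    rw [← cubeChar_mul_cubeChar]
    simp only [Pi.smul_apply, Pi.add_apply, smul_eq_mul]
    linear_combination -(1 / 2) * h1 - b ^ 2 / 2 * h2 - 1 / 2 * hb
  rcases le_total 0 a with ha | ha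
  · convert (key 1 (by norm_num)).smul ha using 1
    ext x
    simp only [Pi.smul_apply, smul_eq_mul, abs_of_nonneg ha]
    ring
  · convert (key (-1) (by norm_num)).smul (neg_nonneg.mpr ha) using 1
    ext x
    simp only [Pi.smul_apply, smul_eq_mul, abs_of_nonpos ha]
    ring

theorem fourierCoefficient_eq_zero_of_isSumSqOf {n d : ℕ} {q : Cube n → ℝ}
    (hq : IsSumSqOf (sosSubspace n d) q) {A : Finset (Fin n)}
    (hA : ∀ S T : Finset (Fin n), 2 * S.card ≤ d → 2 * T.card ≤ d → symmDiff S T ≠ A) :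
    fourierCoefficient q A = 0 := by
  obtain ⟨t, g, hg, hq⟩ := hq
  have h : ∀ x, q x * cubeChar A x = ∑ j, ∑ S, ∑ T, fourierCoefficient (g j) S *
      fourierCoefficient (g j) T * (cubeChar (symmDiff S T) x * cubeChar A x) := by
    intro x
    rw [hq x, Finset.sum_mul]
    refine Finset.sum_congr rfl fun j _ => ?_
    rw [sq, fourier_inversion (g j) x, Finset.sum_mul_sum, Finset.sum_mul]
    refine Finset.sum_congr rfl fun S _ => ?_
    rw [Finset.sum_mul]
    refine Finset.sum_congr rfl fun T _ => ?_
    rw [← cubeChar_mul_cubeChar]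
    ring
  have h0 : ∑ x, q x * cubeChar A x = 0 := by
    simp only [h]
    rw [Finset.sum_comm]
    refine Finset.sum_eq_zero fun j _ => ?_
    rw [Finset.sum_comm]
    refine Finset.sum_eq_zero fun S _ => ?_
    rw [Finset.sum_comm]
    refine Finset.sum_eq_zero fun T _ => ?_
    rw [← Finset.mul_sum, sum_cubeChar_mul_cubeChar]
    by_cases hS : 2 * S.card ≤ d
    · by_cases hT : 2 * T.card ≤ d
      · rw [if_neg (hA S T hS hT), mul_zero]
      · rw [mem_sosSubspace_iff.mp (hg j) T (by omega)]
        simp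
    · rw [mem_sosSubspace_iff.mp (hg j) S (by omega)]
      simp
  unfold fourierCoefficient
  rw [h0, zero_div]

theorem abs_fourierCoefficient_le {n : ℕ} {f : Cube n → ℝ} {η : ℝ} (hf : ∀ x, |f x| ≤ η)
    (S : Finset (Fin n)) : |fourierCoefficient f S| ≤ η := by
  unfold fourierCoefficient
  rw [abs_div, abs_of_pos (by positivity : (0 : ℝ) < 2 ^ n), div_le_iff₀ (by positivity)]
  refine (Finset.abs_sum_le_sum_abs _ _).trans ?_
  have : ∀ x ∈ (Finset.univ : Finset (Cube n)), |f x * cubeChar S x| ≤ η := by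
    intro x _
    have h1 : |cubeChar S x| = 1 := by
      have h2 := cubeChar_mul_self S x
      rw [← abs_mul_abs_self] at h2
      nlinarith [abs_nonneg (cubeChar S x)]
    rw [abs_mul, h1, mul_one]
    exact hf x
  refine (Finset.sum_le_card_nsmul _ _ _ this).trans_eq ?_
  simp
  ring

theorem continuous_fourierCoefficient {n : ℕ} (S : Finset (Fin n)) :
    Continuous fun f : Cube n → ℝ => fourierCoefficient f S := by
  unfold fourierCoefficient
  fun_prop

/-- Replaces closedness of the cone. A nearby `q` in the cone differs from `p` only by products of
two low-degree characters, with small coefficients, and each such term becomes a sum of squares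
after adding a small constant; the constants are paid from ε. -/
theorem isSumSqOf_add_of_mem_closure {n d : ℕ} {p : Cube n → ℝ}
    (hp : p ∈ closure {q | IsSumSqOf (sosSubspace n d) q}) {ε : ℝ} (hε : 0 < ε) :
    IsSumSqOf (sosSubspace n d) fun x => p x + ε := by
  classical
  have hzero : ∀ q ∈ closure {q | IsSumSqOf (sosSubspace n d) q}, ∀ A : Finset (Fin n),
      (∀ S T : Finset (Fin n), 2 * S.card ≤ d → 2 * T.card ≤ d → symmDiff S T ≠ A) →
      fourierCoefficient q A = 0 := by
    intro q hq A hA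
    refine closure_minimal (fun q hq => fourierCoefficient_eq_zero_of_isSumSqOf hq hA)
      (isClosed_singleton.preimage (continuous_fourierCoefficient A)) hq
  -- A crude tolerance: there are 2^n characters and 2^n ≤ 2^(2^n), so the coefficients of p - q add
  -- up to at most ε in absolute value.
  obtain ⟨q, hq, hdist⟩ := Metric.mem_closure_iff.mp hp (ε / 2 ^ 2 ^ n) (by positivity)
  have hcoef : ∀ A, |fourierCoefficient (p - q) A| ≤ ε / 2 ^ 2 ^ n := by
    refine fun A => abs_fourierCoefficient_le (fun x => ?_) A
    exact (dist_le_pi_dist p q x).trans hdist.le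
  have hsub : ∀ A, fourierCoefficient (p - q) A = fourierCoefficient p A - fourierCoefficient q A := by
    intro A
    simp [fourierCoefficient, sub_mul, Finset.sum_sub_distrib, sub_div]
  have hsum : IsSumSqOf (sosSubspace n d) (∑ A : Finset (Fin n), fun x =>
      |fourierCoefficient (p - q) A| + fourierCoefficient (p - q) A * cubeChar A x) := by
    refine isSumSqOf_sum _ _ fun A _ => ?_
    by_cases hA : ∃ S T : Finset (Fin n), 2 * S.card ≤ d ∧ 2 * T.card ≤ d ∧ symmDiff S T = A
    · obtain ⟨S, T, hS, hT, rfl⟩ := hA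
      exact isSumSqOf_one_add_smul_cubeChar hS hT
    · push Not at hA
      have h0 : fourierCoefficient (p - q) A = 0 := by
        rw [hsub, hzero p hp A hA, hzero q (subset_closure hq) A hA, sub_zero]
      simp only [h0, abs_zero, zero_mul, add_zero]
      exact isSumSqOf_zero _
  set C := ∑ A : Finset (Fin n), |fourierCoefficient (p - q) A| with hC
  have hCε : C ≤ ε := by
    have h1 : C ≤ (Finset.univ : Finset (Finset (Fin n))).card • (ε / 2 ^ 2 ^ n) :=
      Finset.sum_le_card_nsmul _ _ _ fun A _ => hcoef A
    rw [Finset.card_univ, Fintype.card_finset, Fintype.card_fin, nsmul_eq_mul] at h1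
    refine h1.trans ?_
    rw [← mul_div_assoc, div_le_iff₀ (by positivity), mul_comm]
    refine mul_le_mul_of_nonneg_left ?_ hε.le
    exact_mod_cast (Nat.lt_two_pow_self (n := 2 ^ n)).le
  have hconst : IsSumSqOf (sosSubspace n d) fun _ => ε - C := by
    convert isSumSqOf_sq (const_mem_sosSubspace (n := n) (d := d) (Real.sqrt (ε - C))) using 1
    ext x
    rw [Real.sq_sqrt (by linarith)]
  convert (IsSumSqOf.add hq hsum).add hconst using 1
  ext x
  simp only [Pi.add_apply, Finset.sum_apply, Finset.sum_add_distrib, ← hC]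
  rw [← fourier_inversion, Pi.sub_apply]
  ring

theorem exists_pseudoDensity {n d : ℕ} {p : Cube n → ℝ} {ε : ℝ} (hε : 0 < ε)
    (hp : ¬ IsSumSqOf (sosSubspace n d) fun x => p x + ε) :
    ∃ D : Cube n → ℝ, (∀ g ∈ sosSubspace n d, 0 ≤ ∑ y, D y * g y ^ 2) ∧ ∑ y, D y * p y < 0 := by
  obtain ⟨D, hD, hneg⟩ := exists_separating_weights (K := {q | IsSumSqOf (sosSubspace n d) q})
    (isSumSqOf_zero _) (fun _ hf _ hg => hf.add hg) (fun _ ha _ hf => hf.smul ha)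
    (fun h => hp (isSumSqOf_add_of_mem_closure h hε))
  exact ⟨D, fun g hg => hD _ (isSumSqOf_sq hg), hneg⟩

/-! ### Spectral concentration -/

/-- Here `l` stands for an eigenvalue of T and `q` for the corresponding diagonal entry of Q. If l >
-δ, the first term on the right dominates; if -2δ ≤ l ≤ -δ, the left side is nonpositive; if l <
-2δ, the left side is at most -δ(B + 2δ)^(2k), and `hκM` keeps the negative term on the right above
that. -/
theorem mul_pow_le_of_spectral_bound {B δ M q l κ : ℝ} (k : ℕ) (hB : 0 < B) (hδ : 0 ≤ δ)
    (hδB : δ ≤ B) (hκ : 0 ≤ κ) (hκM : κ * (B * M) ≤ δ * (B + 2 * δ) ^ (2 * k))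
    (hl : -B ≤ l) (hlB : l ≤ B) (hq : 0 ≤ q) (hqM : q ≤ M) :
    (l + δ) * (B - l) ^ (2 * k) ≤ 2 * B * (B + δ) ^ (2 * k) + κ * (q * (l + 2 * δ)) := by
  have hpos : 0 ≤ 2 * B * (B + δ) ^ (2 * k) := by positivity
  have hpow : 0 ≤ (B - l) ^ (2 * k) := pow_nonneg (by linarith) _
  rcases le_or_gt (-(2 * δ)) l with h | h
  · have h1 : 0 ≤ κ * (q * (l + 2 * δ)) := mul_nonneg hκ (mul_nonneg hq (by linarith))
    rcases le_or_gt l (-δ) with h2 | h2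
    · have : (l + δ) * (B - l) ^ (2 * k) ≤ 0 :=
        mul_nonpos_of_nonpos_of_nonneg (by linarith) hpow
      linarith
    · have h3 : (B - l) ^ (2 * k) ≤ (B + δ) ^ (2 * k) :=
        pow_le_pow_left₀ (by linarith) (by linarith) _
      have h4 : (l + δ) * (B - l) ^ (2 * k) ≤ 2 * B * (B + δ) ^ (2 * k) :=
        mul_le_mul (by linarith) h3 hpow (by linarith)
      linarith
  · have h1 : (B + 2 * δ) ^ (2 * k) ≤ (B - l) ^ (2 * k) :=
      pow_le_pow_left₀ (by linarith) (by linarith) _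
    have h2 : δ * (B + 2 * δ) ^ (2 * k) ≤ -(l + δ) * (B - l) ^ (2 * k) :=
      mul_le_mul (by linarith) h1 (by positivity) (by linarith)
    have h3 : q * -(l + 2 * δ) ≤ M * B :=
      mul_le_mul hqM (by linarith) (by linarith) (by linarith)
    have h4 : κ * (q * -(l + 2 * δ)) ≤ κ * (M * B) := mul_le_mul_of_nonneg_left h3 hκ
    linarith

namespace Matrix

theorem exists_algEquiv_diagonal {r : ℕ} {T : Matrix (Fin r) (Fin r) ℝ} (hT : T.IsHermitian) :
    ∃ (φ : Matrix (Fin r) (Fin r) ℝ ≃ₐ[ℝ] Matrix (Fin r) (Fin r) ℝ) (l : Fin r → ℝ),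
      T = φ (diagonal l) ∧ (∀ A, (φ A).trace = A.trace) ∧
        ∀ A : Matrix (Fin r) (Fin r) ℝ, A.PosSemidef → (φ.symm A).PosSemidef := by
  refine ⟨(Unitary.conjStarAlgAut ℝ _ hT.eigenvectorUnitary).toAlgEquiv, hT.eigenvalues,
    hT.spectral_theorem, fun A => ?_, fun A hA => ?_⟩
  · change (Unitary.conjStarAlgAut ℝ _ hT.eigenvectorUnitary A).trace = _
    rw [Unitary.conjStarAlgAut_apply, trace_mul_cycle]
    simp
  · change ((Unitary.conjStarAlgAut ℝ _ hT.eigenvectorUnitary).symm A).PosSemidef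
    rw [Unitary.conjStarAlgAut_symm_apply]
    exact hA.conjTranspose_mul_mul_same _

/-- In an eigenbasis of `T` only the diagonal of `Q` matters, so the scalar bound can be summed over
the eigenvalues; their number is the factor `r` that forces k to grow like log r. -/
theorem trace_mul_pow_le {r : ℕ} {T Q : Matrix (Fin r) (Fin r) ℝ} {B δ M κ : ℝ} (k : ℕ)
    (hB : 0 < B) (hδ : 0 ≤ δ) (hδB : δ ≤ B) (hκ : 0 ≤ κ)
    (hκM : κ * (B * M) ≤ δ * (B + 2 * δ) ^ (2 * k)) (hT : T.IsHermitian)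
    (hT1 : (B • (1 : Matrix (Fin r) (Fin r) ℝ) - T).PosSemidef)
    (hT2 : (B • (1 : Matrix (Fin r) (Fin r) ℝ) + T).PosSemidef)
    (hQ : Q.PosSemidef) (hQM : Q.trace ≤ M) :
    (T * (B • (1 : Matrix (Fin r) (Fin r) ℝ) - T) ^ (2 * k)).trace +
        δ * ((B • (1 : Matrix (Fin r) (Fin r) ℝ) - T) ^ (2 * k)).trace ≤
      r * (2 * B * (B + δ) ^ (2 * k)) + κ * ((T * Q).trace + 2 * δ * Q.trace) := by
  obtain ⟨φ, l, rfl, htr, hpsd⟩ := exists_algEquiv_diagonal hT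
  obtain ⟨Q, rfl⟩ := φ.surjective Q
  have hone : B • (1 : Matrix (Fin r) (Fin r) ℝ) = diagonal fun _ => B := by
    rw [← diagonal_one, ← diagonal_smul]
    simp [Pi.smul_def]
  have hφone : B • (1 : Matrix (Fin r) (Fin r) ℝ) = φ (diagonal fun _ => B) := by
    rw [← hone, map_smul, map_one]
  rw [hφone, ← map_sub, diagonal_sub] at hT1
  rw [hφone, ← map_add, diagonal_add] at hT2
  have hT1 := hpsd _ hT1
  have hT2 := hpsd _ hT2
  have hQ := hpsd _ hQ
  rw [AlgEquiv.symm_apply_apply] at hT1 hT2 hQ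
  rw [htr] at hQM
  rw [hφone, ← map_sub, ← map_pow, ← map_mul, ← map_mul, htr, htr, htr, htr, diagonal_sub,
    diagonal_pow, diagonal_mul_diagonal]
  simp only [trace, diag_apply, diagonal_apply_eq, diagonal_mul, Pi.pow_apply]
  rw [Finset.mul_sum, ← Finset.sum_add_distrib, Finset.mul_sum, ← Finset.sum_add_distrib,
    Finset.mul_sum]
  have hcard : (r : ℝ) * (2 * B * (B + δ) ^ (2 * k))
      = ∑ _i : Fin r, 2 * B * (B + δ) ^ (2 * k) := by simp
  rw [hcard, ← Finset.sum_add_distrib]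
  refine Finset.sum_le_sum fun i _ => ?_
  have h1 := hT1.diag_nonneg (i := i)
  have h2 := hT2.diag_nonneg (i := i)
  rw [diagonal_apply_eq] at h1 h2
  have hqi : Q i i ≤ M := le_trans
    (Finset.single_le_sum (f := fun i => Q i i) (fun j _ => hQ.diag_nonneg) (Finset.mem_univ i)) hQM
  have := mul_pow_le_of_spectral_bound k hB hδ hδB hκ hκM (l := l i) (by linarith) (by linarith)
    hQ.diag_nonneg hqi
  calc _ = (l i + δ) * (B - l i) ^ (2 * k) := by ring
    _ ≤ _ := this
    _ = _ := by ring

end Matrix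

/-! ### Low-degree matrix functions -/

namespace Matrix

theorem trace_mul_mul_self {r : ℕ} {P R : Matrix (Fin r) (Fin r) ℝ} (hR : R.IsHermitian) :
    (P * (R * R)).trace = ∑ j, (fun i => R i j) ⬝ᵥ P *ᵥ fun i => R i j := by
  rw [← mul_assoc, trace_mul_comm]
  simp only [trace, diag_apply, mul_apply, dotProduct, mulVec]
  refine Finset.sum_congr rfl fun j _ => Finset.sum_congr rfl fun i _ => ?_
  rw [← hR.apply i j]
  simp

theorem PosSemidef.exists_sq_sum {r : ℕ} {P : Matrix (Fin r) (Fin r) ℝ} (hP : P.PosSemidef) :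
    ∃ G : Matrix (Fin r) (Fin r) ℝ, ∀ v, v ⬝ᵥ P *ᵥ v = ∑ a, (G *ᵥ v) a ^ 2 := by
  obtain ⟨G, rfl⟩ : ∃ G : Matrix (Fin r) (Fin r) ℝ, P = Gᴴ * G := by
    open scoped MatrixOrder in
    obtain ⟨G, hG⟩ := CStarAlgebra.nonneg_iff_eq_star_mul_self.mp hP.nonneg
    exact ⟨G, hG⟩
  refine ⟨G, fun v => ?_⟩
  rw [← mulVec_mulVec, dotProduct_mulVec, conjTranspose_eq_transpose_of_trivial,
    vecMul_transpose]
  simp [dotProduct, sq]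

end Matrix

/-- The low part `l` contributes a nonnegative amount; the cross term with the high part `u` is
split by the weighted AM-GM inequality with weight θ. -/
theorem pseudoDensity_sq_ge {m n d : ℕ} {D : Cube m → ℝ}
    (hD : ∀ g ∈ sosSubspace m d, 0 ≤ ∑ y, D y * g y ^ 2) {B θ : ℝ} (hB : ∀ y, |D y| ≤ B)
    (hθ : 0 < θ) (σ : Fin m ↪ Fin n) {l u : Cube n → ℝ} (hl : l ∈ lowSubspace σ d) :
    -(B * θ * ∑ x, (l x + u x) ^ 2 + B * (1 + 1 / θ) * ∑ x, u x ^ 2) ≤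
      ∑ x : Cube n, D (fun i => x (σ i)) * (l x + u x) ^ 2 := by
  have h := pseudoDensity_sq_nonneg hD σ hl
  have hpt : ∀ x : Cube n, D (fun i => x (σ i)) * l x ^ 2 -
      (B * θ * (l x + u x) ^ 2 + B * (1 + 1 / θ) * u x ^ 2) ≤
      D (fun i => x (σ i)) * (l x + u x) ^ 2 := by
    intro x
    obtain ⟨h1, h2⟩ := abs_le.mp (hB fun i => x (σ i))
    generalize D (fun i => x (σ i)) = a at h1 h2
    obtain ⟨w, hw⟩ : ∃ w, w = 1 / θ := ⟨_, rfl⟩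
    have hwθ : w * θ = 1 := by rw [hw]; field_simp
    have hw0 : 0 < w := by rw [hw]; positivity
    rw [← hw]
    obtain ⟨s, hs⟩ : ∃ s, s = l x + u x := ⟨_, rfl⟩
    have hl : l x = s - u x := by linarith
    rw [← hs, hl]
    have e1 : 0 ≤ w * (θ * s + u x) ^ 2 := by positivity
    have e2 : 0 ≤ w * (θ * s - u x) ^ 2 := by positivity
    have e3 : w * (θ * s + u x) ^ 2 = θ * s ^ 2 + 2 * s * u x + w * u x ^ 2 := by
      linear_combination (θ * s ^ 2 + 2 * s * u x) * hwθ
    have e4 : w * (θ * s - u x) ^ 2 = θ * s ^ 2 - 2 * s * u x + w * u x ^ 2 := by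
      linear_combination (θ * s ^ 2 - 2 * s * u x) * hwθ
    have e5 : |2 * s * u x - u x ^ 2| ≤ θ * s ^ 2 + (1 + w) * u x ^ 2 := by
      rw [abs_le]
      constructor <;> nlinarith [sq_nonneg (u x)]
    have e6 := (abs_le.mp (abs_mul a _ ▸ mul_le_mul (abs_le.mpr ⟨h1, h2⟩) e5 (abs_nonneg _)
      (by linarith [abs_nonneg a, abs_le.mpr ⟨h1, h2⟩]))).1
    linarith
  have hsum := Finset.sum_le_sum fun x (_ : x ∈ (Finset.univ : Finset (Cube n))) => hpt x
  rw [Finset.sum_sub_distrib, Finset.sum_add_distrib, ← Finset.mul_sum, ← Finset.mul_sum] at hsum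
  linarith

open Matrix in
theorem pseudoDensity_quadForm_ge {m n d r : ℕ} {D : Cube m → ℝ}
    (hD : ∀ g ∈ sosSubspace m d, 0 ≤ ∑ y, D y * g y ^ 2) {B θ : ℝ} (hB : ∀ y, |D y| ≤ B)
    (hθ : 0 < θ) (σ : Fin m ↪ Fin n) {P : Matrix (Fin r) (Fin r) ℝ} (hP : P.PosSemidef)
    (f : Fin r → Cube n → ℝ) :
    -(B * θ * ∑ x, (fun i => f i x) ⬝ᵥ P *ᵥ (fun i => f i x) + B * (1 + 1 / θ) *
      ∑ x, (fun i => fourierProj (highSets σ d) (f i) x) ⬝ᵥ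
        P *ᵥ (fun i => fourierProj (highSets σ d) (f i) x)) ≤
      ∑ x : Cube n, D (fun i => x (σ i)) * ((fun i => f i x) ⬝ᵥ P *ᵥ (fun i => f i x)) := by
  obtain ⟨G, hG⟩ := hP.exists_sq_sum
  simp only [hG, Finset.mul_sum]
  rw [Finset.sum_comm, Finset.sum_comm (f := fun x a => B * (1 + 1 / θ) * _),
    Finset.sum_comm (f := fun x a => D _ * _), ← Finset.sum_add_distrib,
    ← Finset.sum_neg_distrib]
  refine Finset.sum_le_sum fun a _ => ?_
  have hl : (∑ i, G a i • fourierProj (highSets σ d)ᶜ (f i)) ∈ lowSubspace σ d :=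
    Submodule.sum_mem _ fun i _ =>
      Submodule.smul_mem _ _ (fourierProj_compl_highSets_mem σ d (f i))
  have h := pseudoDensity_sq_ge hD hB hθ σ
    (u := fun x => (G *ᵥ fun i => fourierProj (highSets σ d) (f i) x) a) hl
  have hsum : ∀ x, (∑ i, G a i • fourierProj (highSets σ d)ᶜ (f i)) x +
      (G *ᵥ fun i => fourierProj (highSets σ d) (f i) x) a = (G *ᵥ fun i => f i x) a := by
    intro x
    simp only [Finset.sum_apply, Pi.smul_apply, smul_eq_mul, mulVec, dotProduct]
    rw [← Finset.sum_add_distrib]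
    refine Finset.sum_congr rfl fun i _ => ?_
    rw [← mul_add, add_comm, fourierProj_add_compl]
  simp only [hsum, Finset.mul_sum] at h
  exact h

-- Apply the quadratic form bound to each column of `R`. The θ-terms add up over σ because ∑ P_σ ≤
-- 1; in the high parts the uniform bound on P_σ removes the matrix and leaves only the average high
-- Fourier weight of the entries of `R`.
open Matrix in
theorem sum_trace_mul_sq_ge {m n N d r a : ℕ} {D : Cube m → ℝ}
    (hD : ∀ g ∈ sosSubspace m d, 0 ≤ ∑ y, D y * g y ^ 2) {B θ K : ℝ} (hB0 : 0 ≤ B)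
    (hB : ∀ y, |D y| ≤ B) (hθ : 0 < θ) (hK : 0 ≤ K) (hN : 0 < N) (e : Fin m × Fin N ↪ Fin n)
    {P : (Fin m → Fin N) → Matrix (Fin r) (Fin r) ℝ} (hP : ∀ σ, (P σ).PosSemidef)
    (hPsum : ∀ v, ∑ σ, v ⬝ᵥ P σ *ᵥ v ≤ v ⬝ᵥ v)
    (hPK : ∀ σ v, v ⬝ᵥ P σ *ᵥ v ≤ K / (N : ℝ) ^ m * (v ⬝ᵥ v))
    {R : Cube n → Matrix (Fin r) (Fin r) ℝ} (hR : ∀ x, (R x).IsHermitian)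
    (hdeg : ∀ i j, (fun x => R x i j) ∈ sosSubspace n (2 * a)) :
    -((B * θ + B * (1 + 1 / θ) * (K * (2 ^ m * (a / N) ^ (d / 2 + 1)))) *
      ∑ x, (R x * R x).trace) ≤
      ∑ x, ∑ σ, D (fun i => x (blockEmbedding e σ i)) * (P σ * (R x * R x)).trace := by
  have hNpos : (0 : ℝ) < N := by exact_mod_cast hN
  have hX : ∑ x, (R x * R x).trace = ∑ j, ∑ i, ∑ x, R x i j ^ 2 := by
    have : ∀ x, (R x * R x).trace = ∑ j, ∑ i, R x i j ^ 2 := by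
      intro x
      have h := trace_mul_mul_self (P := 1) (hR x)
      rw [one_mul] at h
      rw [h]
      simp [dotProduct, sq]
    simp only [this]
    rw [Finset.sum_comm]
    exact Finset.sum_congr rfl fun j _ => Finset.sum_comm
  have hlhs : ∑ x, ∑ σ, D (fun i => x (blockEmbedding e σ i)) * (P σ * (R x * R x)).trace
      = ∑ j, ∑ σ, ∑ x, D (fun i => x (blockEmbedding e σ i)) *
        ((fun i => R x i j) ⬝ᵥ P σ *ᵥ fun i => R x i j) := by
    simp only [trace_mul_mul_self (hR _), Finset.mul_sum]
    rw [Finset.sum_comm]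
    simp only [Finset.sum_comm (s := (Finset.univ : Finset (Cube n)))
      (t := (Finset.univ : Finset (Fin r)))]
    rw [Finset.sum_comm]
  rw [hlhs, hX, Finset.mul_sum, ← Finset.sum_neg_distrib]
  refine Finset.sum_le_sum fun j _ => ?_
  have h1 := Finset.sum_le_sum fun σ (_ : σ ∈ (Finset.univ : Finset (Fin m → Fin N))) =>
    pseudoDensity_quadForm_ge hD hB hθ (blockEmbedding e σ) (hP σ) fun i x => R x i j
  refine le_trans ?_ h1
  rw [Finset.sum_neg_distrib, neg_le_neg_iff, Finset.sum_add_distrib, ← Finset.mul_sum,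
    ← Finset.mul_sum, add_mul]
  refine add_le_add ?_ ?_
  · refine mul_le_mul_of_nonneg_left ?_ (mul_nonneg hB0 hθ.le)
    rw [Finset.sum_comm, Finset.sum_comm (s := (Finset.univ : Finset (Fin r)))]
    refine Finset.sum_le_sum fun x _ => (hPsum _).trans_eq ?_
    simp [dotProduct, sq]
  · rw [mul_assoc (B * (1 + 1 / θ))]
    refine mul_le_mul_of_nonneg_left ?_ (mul_nonneg hB0 (by positivity))
    have h2 : ∀ σ x, (fun i => fourierProj (highSets (blockEmbedding e σ) d)
        (fun x => R x i j) x) ⬝ᵥ P σ *ᵥ (fun i => fourierProj (highSets (blockEmbedding e σ) d)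
        (fun x => R x i j) x) ≤ K / (N : ℝ) ^ m * ∑ i, fourierProj
        (highSets (blockEmbedding e σ) d) (fun x => R x i j) x ^ 2 := by
      intro σ x
      refine (hPK σ _).trans_eq ?_
      simp [dotProduct, sq]
    refine (Finset.sum_le_sum fun σ _ => Finset.sum_le_sum fun x _ => h2 σ x).trans ?_
    simp only [← Finset.mul_sum]
    simp only [Finset.sum_comm (s := (Finset.univ : Finset (Cube n)))
      (t := (Finset.univ : Finset (Fin r)))]
    rw [Finset.sum_comm, Finset.mul_sum, Finset.mul_sum]
    refine Finset.sum_le_sum fun i _ => ?_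
    have h3 := sum_fourierProj_highSets_le e d (hdeg i j)
    rw [mul_comm, ← le_div_iff₀ (by positivity)] at h3
    refine (mul_le_mul_of_nonneg_left h3 (by positivity)).trans_eq ?_
    rw [div_pow]
    field_simp

theorem mul_apply_mem_sosSubspace {n r a b : ℕ} {R S : Cube n → Matrix (Fin r) (Fin r) ℝ}
    (hR : ∀ i j, (fun x => R x i j) ∈ sosSubspace n a)
    (hS : ∀ i j, (fun x => S x i j) ∈ sosSubspace n b) (i j : Fin r) :
    (fun x => (R x * S x) i j) ∈ sosSubspace n (a + b) := by
  have h : (fun x => (R x * S x) i j) = ∑ l, (fun x => R x i l) * fun x => S x l j := by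
    ext x
    simp [Matrix.mul_apply]
  rw [h]
  exact Submodule.sum_mem _ fun l _ => mul_mem_sosSubspace (hR i l) (hS l j)

theorem pow_apply_mem_sosSubspace {n r a : ℕ} {R : Cube n → Matrix (Fin r) (Fin r) ℝ}
    (hR : ∀ i j, (fun x => R x i j) ∈ sosSubspace n (2 * a)) (k : ℕ) (i j : Fin r) :
    (fun x => (R x ^ k) i j) ∈ sosSubspace n (2 * (k * a)) := by
  induction k generalizing i j with
  | zero => exact const_mem_sosSubspace _
  | succ k ih =>
    simp only [pow_succ]
    have := mul_apply_mem_sosSubspace ih hR i j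
    rwa [show 2 * (k * a) + 2 * a = 2 * ((k + 1) * a) by ring] at this

-- Test against R² with R = (B - T)^k instead of `Q`. The pseudo-density bound gives ∑ Tr(T R²) + δ
-- ∑ Tr(R²) ≥ 0, while the spectral bound together with a too negative ∑ Tr(T Q) makes the same
-- quantity negative.
open Matrix in
theorem sum_trace_mul_gt {m n N d r k : ℕ} {D : Cube m → ℝ}
    (hD : ∀ g ∈ sosSubspace m d, 0 ≤ ∑ y, D y * g y ^ 2) {B θ K δ ε C M : ℝ} (hB0 : 0 < B)
    (hB : ∀ y, |D y| ≤ B) (hθ : 0 < θ) (hK : 0 ≤ K) (hN : 0 < N) (e : Fin m × Fin N ↪ Fin n)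
    {P : (Fin m → Fin N) → Matrix (Fin r) (Fin r) ℝ} (hP : ∀ σ, (P σ).PosSemidef)
    (hPsum : ∀ v, ∑ σ, v ⬝ᵥ P σ *ᵥ v ≤ v ⬝ᵥ v)
    (hPK : ∀ σ v, v ⬝ᵥ P σ *ᵥ v ≤ K / (N : ℝ) ^ m * (v ⬝ᵥ v))
    {Q : Cube n → Matrix (Fin r) (Fin r) ℝ} (hQ : ∀ x, (Q x).PosSemidef)
    (hQM : ∀ x, (Q x).trace ≤ M) (hQC : ∑ x, (Q x).trace ≤ C * 2 ^ n) (hM : 0 < M)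
    (hδ : 0 < δ) (hδB : δ ≤ B) (hδC : 4 * δ * C ≤ ε)
    (hk : 4 * r * B ^ 2 * M * (B + δ) ^ (2 * k) < δ * ε * (B + 2 * δ) ^ (2 * k))
    (herr : B * θ + B * (1 + 1 / θ) * (K * (2 ^ m * ((k * m : ℕ) / N) ^ (d / 2 + 1))) ≤ δ) :
    -(ε * 2 ^ n) <
      ∑ x, ∑ σ, D (fun i => x (blockEmbedding e σ i)) * (P σ * Q x).trace := by
  by_contra hcon
  rw [not_lt] at hcon
  set T : Cube n → Matrix (Fin r) (Fin r) ℝ :=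
    fun x => ∑ σ, D (fun i => x (blockEmbedding e σ i)) • P σ with hTdef
  have htr : ∀ x A, (T x * A).trace =
      ∑ σ, D (fun i => x (blockEmbedding e σ i)) * (P σ * A).trace := by
    intro x A
    simp [hTdef, Finset.sum_mul, trace_sum]
  have hTherm : ∀ x, (T x).IsHermitian := fun x => by
    rw [IsHermitian, hTdef, conjTranspose_sum]
    refine Finset.sum_congr rfl fun σ _ => ?_
    rw [conjTranspose_smul, (hP σ).1.eq, star_trivial]
  have hquad : ∀ x v, |v ⬝ᵥ T x *ᵥ v| ≤ B * (v ⬝ᵥ v) := by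
    intro x v
    have h1 : v ⬝ᵥ T x *ᵥ v =
        ∑ σ, D (fun i => x (blockEmbedding e σ i)) * (v ⬝ᵥ P σ *ᵥ v) := by
      simp [hTdef, sum_mulVec, dotProduct_sum, smul_mulVec]
    rw [h1]
    refine (Finset.abs_sum_le_sum_abs _ _).trans ?_
    refine le_trans ?_ (mul_le_mul_of_nonneg_left (hPsum v) hB0.le)
    rw [Finset.mul_sum]
    refine Finset.sum_le_sum fun σ _ => ?_
    have h2 : 0 ≤ v ⬝ᵥ P σ *ᵥ v := by simpa using (hP σ).dotProduct_mulVec_nonneg v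
    rw [abs_mul, abs_of_nonneg h2]
    exact mul_le_mul_of_nonneg_right (hB _) h2
  have hone : (B • (1 : Matrix (Fin r) (Fin r) ℝ)).IsHermitian := by
    rw [IsHermitian, conjTranspose_smul, conjTranspose_one, star_trivial]
  have hT1 : ∀ x, (B • (1 : Matrix (Fin r) (Fin r) ℝ) - T x).PosSemidef := fun x => by
    refine .of_dotProduct_mulVec_nonneg (hone.sub (hTherm x)) fun v => ?_
    have := (abs_le.mp (hquad x v)).2
    simp only [star_trivial, sub_mulVec, smul_mulVec, one_mulVec, dotProduct_sub, dotProduct_smul,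
      smul_eq_mul]
    linarith
  have hT2 : ∀ x, (B • (1 : Matrix (Fin r) (Fin r) ℝ) + T x).PosSemidef := fun x => by
    refine .of_dotProduct_mulVec_nonneg (hone.add (hTherm x)) fun v => ?_
    have := (abs_le.mp (hquad x v)).1
    simp only [star_trivial, add_mulVec, smul_mulVec, one_mulVec, dotProduct_add, dotProduct_smul,
      smul_eq_mul]
    linarith
  set R : Cube n → Matrix (Fin r) (Fin r) ℝ :=
    fun x => (B • (1 : Matrix (Fin r) (Fin r) ℝ) - T x) ^ k with hRdef
  have hR : ∀ x, (R x).IsHermitian := fun x => (hone.sub (hTherm x)).pow k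
  have hRR : ∀ x, (B • (1 : Matrix (Fin r) (Fin r) ℝ) - T x) ^ (2 * k) = R x * R x := fun x => by
    rw [hRdef, ← pow_add, two_mul]
  have hTdeg : ∀ i j, (fun x => T x i j) ∈ sosSubspace n (2 * m) := by
    intro i j
    have h : (fun x => T x i j) = ∑ σ, P σ i j •
        fun x : Cube n => D fun i => x (blockEmbedding e σ i) := by
      ext x
      simp [hTdef, Matrix.sum_apply, mul_comm]
    rw [h]
    refine Submodule.sum_mem _ fun σ _ => Submodule.smul_mem _ _ (comp_mem_sosSubspace _ ?_)
    rw [sosSubspace_eq_top le_rfl]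
    trivial
  have hdeg : ∀ i j, (fun x => R x i j) ∈ sosSubspace n (2 * (k * m)) := by
    refine pow_apply_mem_sosSubspace (fun i j => ?_) k
    exact Submodule.sub_mem _ (const_mem_sosSubspace ((B • (1 : Matrix (Fin r) (Fin r) ℝ)) i j))
      (hTdeg i j)
  have hlow := sum_trace_mul_sq_ge hD hB0.le hB hθ hK hN e hP hPsum hPK hR hdeg
  have hXnonneg : 0 ≤ ∑ x, (R x * R x).trace := Finset.sum_nonneg fun x _ => by
    have := posSemidef_conjTranspose_mul_self (R x)
    rw [(hR x).eq] at this
    exact this.trace_nonneg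
  have hlow2 : -(δ * ∑ x, (R x * R x).trace) ≤ ∑ x, (T x * (R x * R x)).trace := by
    simp only [htr]
    refine le_trans (neg_le_neg ?_) hlow
    exact mul_le_mul_of_nonneg_right herr hXnonneg
  -- The largest weight on `Q` that the spectral bound permits; `hk` says that it beats the loss
  -- from the `r` eigenvalues.
  set κ := δ * (B + 2 * δ) ^ (2 * k) / (B * M) with hκ
  have hκ0 : 0 < κ := by positivity
  have hup : ∀ x, _ := fun x => trace_mul_pow_le k hB0 hδ.le hδB hκ0.le
    (by rw [hκ]; exact (div_mul_cancel₀ _ (by positivity)).le) (hTherm x) (hT1 x) (hT2 x)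
    (hQ x) (hQM x)
  have hsum := Finset.sum_le_sum fun x (_ : x ∈ (Finset.univ : Finset (Cube n))) => hup x
  simp only [hRR, Finset.sum_add_distrib, ← Finset.mul_sum] at hsum
  simp only [← htr] at hcon
  rw [Finset.sum_const, Finset.card_univ, Fintype.card_fun, Fintype.card_bool, Fintype.card_fin,
    nsmul_eq_mul] at hsum
  push_cast at hsum
  have h5 : 2 * δ * ∑ x, (Q x).trace ≤ ε / 2 * 2 ^ n := by
    calc _ ≤ 2 * δ * (C * 2 ^ n) := mul_le_mul_of_nonneg_left hQC (by positivity)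
      _ = (4 * δ * C) * (2 ^ n / 2) := by ring
      _ ≤ ε * (2 ^ n / 2) := mul_le_mul_of_nonneg_right hδC (by positivity)
      _ = _ := by ring
  have h6 : κ * (∑ x, (T x * Q x).trace + 2 * δ * ∑ x, (Q x).trace) ≤ κ * (-(ε / 2) * 2 ^ n) :=
    mul_le_mul_of_nonneg_left (by linarith) hκ0.le
  have h7 : r * (2 * B * (B + δ) ^ (2 * k)) < κ * (ε / 2) := by
    rw [hκ, div_mul_eq_mul_div, lt_div_iff₀ (by positivity)]
    linarith
  have h8 := mul_lt_mul_of_pos_left h7 (by positivity : (0 : ℝ) < 2 ^ n)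
  linarith

/-! ### Normalization of positive semidefinite factorizations -/

namespace Matrix

theorem PosSemidef.quadForm_le_trace {r : ℕ} {P : Matrix (Fin r) (Fin r) ℝ} (hP : P.PosSemidef)
    (v : Fin r → ℝ) : v ⬝ᵥ P *ᵥ v ≤ P.trace * (v ⬝ᵥ v) := by
  obtain ⟨G, hG⟩ := hP.exists_sq_sum
  have htr : P.trace = ∑ a, ∑ i, G a i ^ 2 := by
    rw [Finset.sum_comm]
    refine Finset.sum_congr rfl fun i _ => ?_
    have := hG (Pi.single i 1)
    simpa using this
  rw [hG, htr, Finset.sum_mul]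
  refine Finset.sum_le_sum fun a _ => ?_
  simp only [mulVec, dotProduct, ← sq]
  exact Finset.sum_mul_sq_le_sq_mul_sq _ _ _

theorem PosSemidef.trace_mul_nonneg {r : ℕ} {P Q : Matrix (Fin r) (Fin r) ℝ} (hP : P.PosSemidef)
    (hQ : Q.PosSemidef) : 0 ≤ (P * Q).trace := by
  obtain ⟨G, rfl⟩ : ∃ G : Matrix (Fin r) (Fin r) ℝ, P = Gᴴ * G := by
    open scoped MatrixOrder in
    obtain ⟨G, hG⟩ := CStarAlgebra.nonneg_iff_eq_star_mul_self.mp hP.nonneg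
    exact ⟨G, hG⟩
  rw [mul_assoc, trace_mul_comm]
  exact (hQ.mul_mul_conjTranspose_same G).trace_nonneg

theorem PosDef.exists_factor {r : ℕ} {A : Matrix (Fin r) (Fin r) ℝ} (hA : A.PosDef) :
    ∃ G W : Matrix (Fin r) (Fin r) ℝ, A = Gᴴ * G ∧ W * G = 1 ∧ G * W = 1 := by
  obtain ⟨G, hG⟩ : ∃ G : Matrix (Fin r) (Fin r) ℝ, A = Gᴴ * G := by
    open scoped MatrixOrder in
    obtain ⟨G, hG⟩ := CStarAlgebra.nonneg_iff_eq_star_mul_self.mp hA.posSemidef.nonneg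
    exact ⟨G, hG⟩
  have hdet : IsUnit G.det := by
    have h := hA.det_pos.ne'
    rw [hG, det_mul] at h
    exact isUnit_iff_ne_zero.mpr (right_ne_zero_of_mul h)
  exact ⟨G, G⁻¹, hG, nonsing_inv_mul G hdet, mul_nonsing_inv G hdet⟩

/-- Change basis so that the sum of the Q's is essentially a multiple of the identity. The trace of
each new P is then, up to scale, the sum of its pairings with all the Q's, which `hC` controls. -/
theorem exists_balanced_factorization {ι κ : Type*} [Fintype ι] [Fintype κ] [Nonempty κ] {r : ℕ}
    (hr : 0 < r) {P : ι → Matrix (Fin r) (Fin r) ℝ} {Q : κ → Matrix (Fin r) (Fin r) ℝ}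
    (hP : ∀ i, (P i).PosSemidef) (hQ : ∀ x, (Q x).PosSemidef) {C : ℝ}
    (hC : ∀ i x, (P i * Q x).trace ≤ C) :
    ∃ (P' : ι → Matrix (Fin r) (Fin r) ℝ) (Q' : κ → Matrix (Fin r) (Fin r) ℝ),
      (∀ i, (P' i).PosSemidef) ∧ (∀ x, (Q' x).PosSemidef) ∧
      (∀ i x, (P' i * Q' x).trace = (P i * Q x).trace) ∧
      (∀ i, (P' i).trace ≤ r * (C + 1)) ∧ ∑ x, (Q' x).trace ≤ Fintype.card κ := by
  obtain ⟨X, hX⟩ : ∃ X : ℝ, X = Fintype.card κ := ⟨_, rfl⟩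
  have hXpos : 0 < X := by
    rw [hX]
    exact_mod_cast Fintype.card_pos
  have hX1 : 1 ≤ X := by
    rw [hX]
    exact_mod_cast Fintype.card_pos
  have hrpos : (0 : ℝ) < r := by exact_mod_cast hr
  have hS : 0 ≤ ∑ i, (P i).trace := Finset.sum_nonneg fun i _ => (hP i).trace_nonneg
  -- A regularization making the sum of the Q's invertible, small enough to add at most 1 to its
  -- pairing with any `P i`.
  set η : ℝ := 1 / (1 + ∑ i, (P i).trace) with hη
  have hηpos : 0 < η := by positivity
  have hηP : ∀ i, η * (P i).trace ≤ 1 := by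
    intro i
    have h1 : (P i).trace ≤ ∑ i, (P i).trace :=
      Finset.single_le_sum (f := fun i => (P i).trace) (fun i _ => (hP i).trace_nonneg)
        (Finset.mem_univ i)
    rw [hη, div_mul_eq_mul_div, one_mul, div_le_one (by positivity)]
    linarith
  have hA : (∑ x, Q x + η • (1 : Matrix (Fin r) (Fin r) ℝ)).PosDef :=
    PosDef.posSemidef_add (posSemidef_sum _ fun x _ => hQ x) (PosDef.one.smul hηpos)
  obtain ⟨G, W, hG, hWG, hGW⟩ := hA.exists_factor
  have hGW' : Wᴴ * Gᴴ = 1 := by rw [← conjTranspose_mul, hGW, conjTranspose_one]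
  have hWG' : Gᴴ * Wᴴ = 1 := by rw [← conjTranspose_mul, hWG, conjTranspose_one]
  refine ⟨fun i => (r / X) • (G * P i * Gᴴ), fun x => (X / r) • (Wᴴ * Q x * W),
    fun i => ((hP i).mul_mul_conjTranspose_same G).smul (by positivity),
    fun x => ((hQ x).conjTranspose_mul_mul_same W).smul (by positivity), fun i x => ?_,
    fun i => ?_, ?_⟩
  · have h1 : G * P i * Gᴴ * (Wᴴ * Q x * W) = G * (P i * Q x * W) := by
      calc _ = G * (P i * (Gᴴ * Wᴴ) * Q x * W) := by simp only [mul_assoc]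
        _ = _ := by rw [hWG', mul_one]
    rw [Matrix.smul_mul, Matrix.mul_smul, smul_smul, h1, trace_smul, trace_mul_comm, mul_assoc, hWG, mul_one]
    rw [show (r : ℝ) / X * (X / r) = 1 by field_simp, one_smul]
  · rw [trace_smul, mul_assoc, trace_mul_comm, mul_assoc, ← hG, mul_add, trace_add, Matrix.mul_smul,
      mul_one, trace_smul, Finset.mul_sum, trace_sum, smul_eq_mul, smul_eq_mul]
    have h1 : ∑ x, (P i * Q x).trace ≤ X * C := by
      have := Finset.sum_le_card_nsmul Finset.univ _ C fun x _ => hC i x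
      rwa [Finset.card_univ, nsmul_eq_mul, ← hX] at this
    have h2 : ∑ x, (P i * Q x).trace + η * (P i).trace ≤ X * (C + 1) := by
      linarith [hηP i]
    calc _ ≤ r / X * (X * (C + 1)) := mul_le_mul_of_nonneg_left h2 (by positivity)
      _ = _ := by field_simp
  · have h1 : ∑ x, ((X / r) • (Wᴴ * Q x * W)).trace
        = X / r * ((1 : Matrix (Fin r) (Fin r) ℝ).trace - η * (Wᴴ * W).trace) := by
      simp only [trace_smul, smul_eq_mul]
      rw [← Finset.mul_sum, ← trace_sum, ← Finset.sum_mul, ← Finset.mul_sum]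
      congr 1
      have h2 : ∑ x, Q x = Gᴴ * G - η • (1 : Matrix (Fin r) (Fin r) ℝ) := by
        rw [← hG, add_sub_cancel_right]
      have h3 : Wᴴ * (Gᴴ * G) * W = 1 := by
        rw [← mul_assoc, hGW', one_mul, hGW]
      rw [h2, mul_sub, sub_mul, h3, Matrix.mul_smul, mul_one, Matrix.smul_mul, trace_sub, trace_smul,
        smul_eq_mul]
    rw [h1, trace_one, Fintype.card_fin, ← hX]
    have h4 : 0 ≤ η * (Wᴴ * W).trace :=
      mul_nonneg hηpos.le (posSemidef_conjTranspose_mul_self W).trace_nonneg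
    calc _ ≤ X / r * r := mul_le_mul_of_nonneg_left (by linarith) (by positivity)
      _ = X := by field_simp

/-- After balancing, change basis by a factor of (average of the P's) + 1. This bounds the sum of
the new P's by the identity; the added 1 makes the change of basis contract vectors on the P side,
so the individual bounds survive, and it adds only Tr Q to the new trace of each Q. -/
theorem exists_whitened_factorization {ι κ : Type*} [Fintype ι] [Nonempty ι] [Fintype κ]
    [Nonempty κ] {r : ℕ} (hr : 0 < r) {P : ι → Matrix (Fin r) (Fin r) ℝ}
    {Q : κ → Matrix (Fin r) (Fin r) ℝ} (hP : ∀ i, (P i).PosSemidef) (hQ : ∀ x, (Q x).PosSemidef)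
    {C : ℝ} (hC : ∀ i x, (P i * Q x).trace ≤ C) :
    ∃ (P' : ι → Matrix (Fin r) (Fin r) ℝ) (Q' : κ → Matrix (Fin r) (Fin r) ℝ),
      (∀ i, (P' i).PosSemidef) ∧ (∀ x, (Q' x).PosSemidef) ∧
      (∀ i x, (P' i * Q' x).trace = (P i * Q x).trace / Fintype.card ι) ∧
      (∀ v, ∑ i, v ⬝ᵥ P' i *ᵥ v ≤ v ⬝ᵥ v) ∧
      (∀ i v, v ⬝ᵥ P' i *ᵥ v ≤ r * (C + 1) / Fintype.card ι * (v ⬝ᵥ v)) ∧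
      ∑ x, (Q' x).trace ≤ (C + 1) * Fintype.card κ := by
  obtain ⟨P, Q, hP, hQ, htr, hPtr, hQtr⟩ : ∃ (P₁ : ι → Matrix (Fin r) (Fin r) ℝ)
      (Q₁ : κ → Matrix (Fin r) (Fin r) ℝ), (∀ i, (P₁ i).PosSemidef) ∧ (∀ x, (Q₁ x).PosSemidef) ∧
      (∀ i x, (P i * Q x).trace = (P₁ i * Q₁ x).trace) ∧
      (∀ i, (P₁ i).trace ≤ r * (C + 1)) ∧ ∑ x, (Q₁ x).trace ≤ Fintype.card κ := by
    obtain ⟨P₁, Q₁, h1, h2, h3, h4⟩ := exists_balanced_factorization hr hP hQ hC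
    exact ⟨P₁, Q₁, h1, h2, fun i x => (h3 i x).symm, h4⟩
  simp only [htr] at hC ⊢
  obtain ⟨L, hL⟩ : ∃ L : ℝ, L = Fintype.card ι := ⟨_, rfl⟩
  have hLpos : 0 < L := by
    rw [hL]
    exact_mod_cast Fintype.card_pos
  have hA : ((1 / L) • ∑ i, P i + (1 : Matrix (Fin r) (Fin r) ℝ)).PosDef :=
    PosDef.posSemidef_add ((posSemidef_sum _ fun i _ => hP i).smul (a := 1 / L) (by positivity)) PosDef.one
  obtain ⟨H, Y, hH, hYH, hHY⟩ := hA.exists_factor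
  have hHY' : Yᴴ * Hᴴ = 1 := by rw [← conjTranspose_mul, hHY, conjTranspose_one]
  have hYH' : Hᴴ * Yᴴ = 1 := by rw [← conjTranspose_mul, hYH, conjTranspose_one]
  rw [← hL]
  have hquad : ∀ (A : Matrix (Fin r) (Fin r) ℝ) v,
      v ⬝ᵥ (Yᴴ * A * Y) *ᵥ v = (Y *ᵥ v) ⬝ᵥ A *ᵥ (Y *ᵥ v) := by
    intro A v
    rw [← mulVec_mulVec, ← mulVec_mulVec, dotProduct_mulVec,
      conjTranspose_eq_transpose_of_trivial, vecMul_transpose]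
  have hident : ∀ v, (1 / L) * ∑ i, (Y *ᵥ v) ⬝ᵥ P i *ᵥ (Y *ᵥ v) + (Y *ᵥ v) ⬝ᵥ (Y *ᵥ v)
      = v ⬝ᵥ v := by
    intro v
    have h1 := hquad ((1 / L) • ∑ i, P i + (1 : Matrix (Fin r) (Fin r) ℝ)) v
    rw [hH, ← mul_assoc, hHY', one_mul, hHY, one_mulVec, ← hH, add_mulVec, smul_mulVec,
      sum_mulVec, one_mulVec, dotProduct_add, dotProduct_smul, dotProduct_sum, smul_eq_mul] at h1
    exact h1.symm
  have hPnonneg : ∀ i v, 0 ≤ v ⬝ᵥ P i *ᵥ v := fun i v => by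
    simpa using (hP i).dotProduct_mulVec_nonneg v
  have hself : ∀ v : Fin r → ℝ, 0 ≤ v ⬝ᵥ v := fun v => by
    simpa using dotProduct_star_self_nonneg v
  refine ⟨fun i => (1 / L) • (Yᴴ * P i * Y), fun x => H * Q x * Hᴴ,
    fun i => ((hP i).conjTranspose_mul_mul_same Y).smul (by positivity),
    fun x => (hQ x).mul_mul_conjTranspose_same H, fun i x => ?_, fun v => ?_, fun i v => ?_, ?_⟩
  · have h1 : Yᴴ * P i * Y * (H * Q x * Hᴴ) = Yᴴ * (P i * Q x * Hᴴ) := by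
      calc _ = Yᴴ * (P i * (Y * H) * Q x * Hᴴ) := by simp only [mul_assoc]
        _ = _ := by rw [hYH, mul_one]
    rw [Matrix.smul_mul, h1, trace_smul, trace_mul_comm, mul_assoc, hYH', mul_one, smul_eq_mul,
      one_div_mul_eq_div]
  · simp only [smul_mulVec, dotProduct_smul, hquad, smul_eq_mul]
    rw [← Finset.mul_sum]
    linarith [hident v, hself (Y *ᵥ v)]
  · simp only [smul_mulVec, dotProduct_smul, hquad, smul_eq_mul]
    have h1 := (hP i).quadForm_le_trace (Y *ᵥ v)
    have h2 : (Y *ᵥ v) ⬝ᵥ (Y *ᵥ v) ≤ v ⬝ᵥ v := by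
      have : 0 ≤ (1 / L) * ∑ i, (Y *ᵥ v) ⬝ᵥ P i *ᵥ (Y *ᵥ v) :=
        mul_nonneg (by positivity) (Finset.sum_nonneg fun i _ => hPnonneg i _)
      linarith [hident v]
    have h3 : (Y *ᵥ v) ⬝ᵥ P i *ᵥ (Y *ᵥ v) ≤ r * (C + 1) * (v ⬝ᵥ v) :=
      h1.trans (mul_le_mul (hPtr i) h2 (hself _) ((hP i).trace_nonneg.trans (hPtr i)))
    calc _ ≤ 1 / L * (r * (C + 1) * (v ⬝ᵥ v)) := mul_le_mul_of_nonneg_left h3 (by positivity)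
      _ = _ := by ring
  · have h1 : ∀ x, (H * Q x * Hᴴ).trace ≤ C + (Q x).trace := by
      intro x
      rw [trace_mul_comm, ← mul_assoc, ← hH, add_mul, one_mul, trace_add, Matrix.smul_mul, trace_smul,
        Finset.sum_mul, trace_sum, smul_eq_mul]
      have h2 := Finset.sum_le_card_nsmul Finset.univ _ C fun i _ => hC i x
      rw [Finset.card_univ, nsmul_eq_mul, ← hL] at h2
      have h3 := mul_le_mul_of_nonneg_left h2 (by positivity : 0 ≤ 1 / L)
      rw [show 1 / L * (L * C) = C by field_simp] at h3
      linarith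
    refine (Finset.sum_le_sum fun x _ => h1 x).trans ?_
    rw [Finset.sum_add_distrib, Finset.sum_const, Finset.card_univ, nsmul_eq_mul]
    linarith

end Matrix

/-! ### Lower bounds on the size of factorizations -/

/-- Whitening controls Tr Q(x) only on average, so the points with trace above `M` are discarded.
Each loses at most BC ≤ (BC/M) Tr Q(x), hence by a Markov argument at most ε/2 on average; the
choice `hM` makes this exact. -/
theorem sum_trace_mul_gt_of_bounded {m n N d r k : ℕ} {D : Cube m → ℝ}
    (hD : ∀ g ∈ sosSubspace m d, 0 ≤ ∑ y, D y * g y ^ 2) {B θ δ ε C M : ℝ} (hB0 : 0 < B)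
    (hB : ∀ y, |D y| ≤ B) (hθ : 0 < θ) (hr : 0 < r) (hN : 0 < N) (e : Fin m × Fin N ↪ Fin n)
    {P : (Fin m → Fin N) → Matrix (Fin r) (Fin r) ℝ} (hP : ∀ σ, (P σ).PosSemidef)
    {Q : Cube n → Matrix (Fin r) (Fin r) ℝ} (hQ : ∀ x, (Q x).PosSemidef)
    (hC0 : 0 < C) (hC : ∀ σ x, (P σ * Q x).trace ≤ C) (hε : 0 < ε)
    (hM : M * ε = 2 * B * C * (C + 1)) (hδ : 0 < δ) (hδB : δ ≤ B) (hδC : 8 * δ * (C + 1) ≤ ε)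
    (hk : 8 * r * B ^ 2 * M * (B + δ) ^ (2 * k) < δ * ε * (B + 2 * δ) ^ (2 * k))
    (herr : B * θ + B * (1 + 1 / θ) *
      (r * (C + 1) * (2 ^ m * ((k * m : ℕ) / N) ^ (d / 2 + 1))) ≤ δ) :
    -(ε * 2 ^ n * (N : ℝ) ^ m) <
      ∑ x, ∑ σ, D (fun i => x (blockEmbedding e σ i)) * (P σ * Q x).trace := by
  classical
  have hNpos : (0 : ℝ) < N := by exact_mod_cast hN
  have : Nonempty (Fin N) := ⟨⟨0, hN⟩⟩
  have hcard : (Fintype.card (Fin m → Fin N) : ℝ) = (N : ℝ) ^ m := by simp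
  have hcard2 : (Fintype.card (Cube n) : ℝ) = 2 ^ n := by simp
  obtain ⟨P', Q', hP', hQ', htr, hPsum, hPK, hQtr⟩ :=
    Matrix.exists_whitened_factorization hr hP hQ hC
  simp only [hcard] at htr hPK
  rw [hcard2] at hQtr
  have hMpos : 0 < M := pos_of_mul_pos_left (by rw [hM]; positivity) hε.le
  set Q₁ : Cube n → Matrix (Fin r) (Fin r) ℝ :=
    fun x => if (Q' x).trace ≤ M then Q' x else 0 with hQ₁
  have hQ₁psd : ∀ x, (Q₁ x).PosSemidef := fun x => by
    simp only [hQ₁]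
    split_ifs
    exacts [hQ' x, Matrix.PosSemidef.zero]
  have hQ₁le : ∀ x, (Q₁ x).trace ≤ (Q' x).trace := fun x => by
    simp only [hQ₁]
    split_ifs
    exacts [le_rfl, by simpa using (hQ' x).trace_nonneg]
  have hQ₁M : ∀ x, (Q₁ x).trace ≤ M := fun x => by
    simp only [hQ₁]
    split_ifs with h
    exacts [h, by simpa using hMpos.le]
  have hcore := sum_trace_mul_gt (ε := ε / 2) (M := M) (C := C + 1) hD hB0 hB hθ
    (K := r * (C + 1)) (by positivity) hN e hP' hPsum hPK hQ₁psd hQ₁M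
    ((Finset.sum_le_sum fun x _ => hQ₁le x).trans hQtr) hMpos hδ hδB (by linarith) (by linarith)
    herr
  have hbad : ∀ x, ∑ σ, D (fun i => x (blockEmbedding e σ i)) * (P' σ * Q₁ x).trace -
      B * C / M * (Q' x).trace ≤
      ∑ σ, D (fun i => x (blockEmbedding e σ i)) * (P' σ * Q' x).trace := by
    intro x
    have h0 := (hQ' x).trace_nonneg
    by_cases h : (Q' x).trace ≤ M
    · have : Q₁ x = Q' x := if_pos h
      rw [this]
      have : 0 ≤ B * C / M * (Q' x).trace := by positivity
      linarith
    · have : Q₁ x = 0 := if_neg h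
      rw [this]
      have h1 : B * C ≤ B * C / M * (Q' x).trace := by
        rw [div_mul_eq_mul_div, le_div_iff₀ hMpos]
        exact mul_le_mul_of_nonneg_left (not_le.mp h).le (by positivity)
      have h2 : ∀ σ ∈ (Finset.univ : Finset (Fin m → Fin N)), -(B * C / (N : ℝ) ^ m) ≤
          D (fun i => x (blockEmbedding e σ i)) * (P' σ * Q' x).trace := by
        intro σ _
        have h3 : 0 ≤ (P' σ * Q' x).trace := (hP' σ).trace_mul_nonneg (hQ' x)
        have h4 : (P' σ * Q' x).trace ≤ C / (N : ℝ) ^ m := by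
          rw [htr]
          exact div_le_div_of_nonneg_right (hC σ x) (by positivity)
        have h5 := (abs_le.mp (hB fun i => x (blockEmbedding e σ i))).1
        have h6 : B * (P' σ * Q' x).trace ≤ B * (C / (N : ℝ) ^ m) :=
          mul_le_mul_of_nonneg_left h4 hB0.le
        have h7 := mul_le_mul_of_nonneg_right h5 h3
        rw [mul_div_assoc]
        linarith
      have h3 := Finset.card_nsmul_le_sum _ _ _ h2
      rw [Finset.card_univ, nsmul_eq_mul, hcard] at h3
      have h4 : (N : ℝ) ^ m * -(B * C / (N : ℝ) ^ m) = -(B * C) := by field_simp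
      simp only [mul_zero, Matrix.trace_zero, Finset.sum_const_zero]
      linarith
  have hsum := Finset.sum_le_sum fun x (_ : x ∈ (Finset.univ : Finset (Cube n))) => hbad x
  rw [Finset.sum_sub_distrib, ← Finset.mul_sum] at hsum
  have hloss : B * C / M * ∑ x, (Q' x).trace ≤ ε / 2 * 2 ^ n := by
    calc _ ≤ B * C / M * ((C + 1) * 2 ^ n) := mul_le_mul_of_nonneg_left hQtr (by positivity)
      _ = (2 * B * C * (C + 1)) / M * (2 ^ n / 2) := by ring
      _ = M * ε / M * (2 ^ n / 2) := by rw [hM]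
      _ = _ := by field_simp
  have htotal : ∑ x, ∑ σ, D (fun i => x (blockEmbedding e σ i)) * (P' σ * Q' x).trace =
      (∑ x, ∑ σ, D (fun i => x (blockEmbedding e σ i)) * (P σ * Q x).trace) / (N : ℝ) ^ m := by
    simp only [htr, Finset.sum_div, mul_div_assoc]
  rw [htotal] at hsum
  have hfinal : -(ε * 2 ^ n) <
      (∑ x, ∑ σ, D (fun i => x (blockEmbedding e σ i)) * (P σ * Q x).trace) / (N : ℝ) ^ m := by
    linarith
  rw [lt_div_iff₀ (by positivity)] at hfinal
  linarith

theorem exists_rate_sum_trace_mul_gt {m d : ℕ} {D : Cube m → ℝ}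
    (hD : ∀ g ∈ sosSubspace m d, 0 ≤ ∑ y, D y * g y ^ 2) {ε C : ℝ} (hC0 : 0 < C) (hε : 0 < ε) :
    ∃ c γ : ℝ, 0 < c ∧ 0 < γ ∧ ∀ (n N r k : ℕ) (e : Fin m × Fin N ↪ Fin n)
      (P : (Fin m → Fin N) → Matrix (Fin r) (Fin r) ℝ) (Q : Cube n → Matrix (Fin r) (Fin r) ℝ),
      0 < N → 0 < r → (∀ σ, (P σ).PosSemidef) → (∀ x, (Q x).PosSemidef) →
      (∀ σ x, (P σ * Q x).trace ≤ C) → c * (1 + Real.log r) ≤ k →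
      r * ((k * m : ℕ) / N : ℝ) ^ (d / 2 + 1) ≤ γ →
      -(ε * 2 ^ n * (N : ℝ) ^ m) <
        ∑ x, ∑ σ, D (fun i => x (blockEmbedding e σ i)) * (P σ * Q x).trace := by
  -- Adding ε makes `B` positive whatever `D` is, and at least ε, which gives δ ≤ B.
  set B : ℝ := ∑ y, |D y| + ε with hBdef
  have hB0 : 0 < B := add_pos_of_nonneg_of_pos (Finset.sum_nonneg fun _ _ => abs_nonneg _) hε
  have hεB : ε ≤ B := le_add_of_nonneg_left (Finset.sum_nonneg fun _ _ => abs_nonneg _)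
  have hB : ∀ y, |D y| ≤ B := fun y =>
    (Finset.single_le_sum (f := fun y => |D y|) (fun _ _ => abs_nonneg _)
      (Finset.mem_univ y)).trans (le_add_of_nonneg_right hε.le)
  set δ : ℝ := ε / (8 * (C + 1)) with hδdef
  have hδ : 0 < δ := by positivity
  have hδC : 8 * δ * (C + 1) = ε := by
    rw [hδdef]
    field_simp
  have hδB : δ ≤ B := by
    refine le_trans ?_ hεB
    rw [← hδC]
    nlinarith
  set M : ℝ := 2 * B * C * (C + 1) / ε with hMdef
  have hM : M * ε = 2 * B * C * (C + 1) := by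
    rw [hMdef]
    field_simp
  have hMpos : 0 < M := by positivity
  set θ : ℝ := δ / (2 * B) with hθdef
  have hθ : 0 < θ := by positivity
  set ρ : ℝ := Real.log ((B + 2 * δ) / (B + δ)) with hρdef
  have hρ : 0 < ρ := Real.log_pos (by rw [one_lt_div (by positivity)]; linarith)
  set c₀ : ℝ := 8 * B ^ 2 * M / (δ * ε) with hc₀def
  have hc₀ : 0 < c₀ := by positivity
  refine ⟨(|Real.log c₀| + 1) / ρ, δ / (2 * (B * (1 + 1 / θ) * ((C + 1) * 2 ^ m))), by positivity,
    by positivity, fun n N r k e P Q hN hr hP hQ hC hk hγ => ?_⟩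
  have hrpos : (0 : ℝ) < r := by exact_mod_cast hr
  have hr1 : (1 : ℝ) ≤ r := by exact_mod_cast hr
  refine sum_trace_mul_gt_of_bounded (k := k) hD hB0 hB hθ hr hN e hP hQ hC0 hC hε hM hδ hδB hδC.le ?_ ?_
  -- Taking logarithms, the amplification ((B + 2δ)/(B + δ))^(2k) must exceed a constant times r.
  · have hlog : 0 ≤ Real.log r := Real.log_nonneg hr1
    rw [div_mul_eq_mul_div, div_le_iff₀ hρ] at hk
    have h1 : Real.log (c₀ * r) < (2 * k : ℕ) * ρ := by
      rw [Real.log_mul hc₀.ne' hrpos.ne']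
      have h2 := le_abs_self (Real.log c₀)
      have h3 : 0 ≤ |Real.log c₀| * Real.log r := mul_nonneg (abs_nonneg _) hlog
      push_cast
      nlinarith
    rw [hρdef, ← Real.log_pow, Real.log_lt_log_iff (by positivity) (by positivity), div_pow,
      lt_div_iff₀ (by positivity), hc₀def, div_mul_eq_mul_div, div_mul_eq_mul_div,
      div_lt_iff₀ (by positivity)] at h1
    linarith
  · have h1 : B * θ = δ / 2 := by
      rw [hθdef]
      field_simp
    rw [le_div_iff₀ (by positivity)] at hγ
    linarith

theorem exists_dimension_bound_sum_trace_mul_gt {m d : ℕ} {D : Cube m → ℝ}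
    (hD : ∀ g ∈ sosSubspace m d, 0 ≤ ∑ y, D y * g y ^ 2) {ε C : ℝ} (hC0 : 0 < C) (hε : 0 < ε) :
    ∃ α : ℝ, 0 < α ∧ ∀ n : ℕ, m ≤ n → 2 ≤ n → ∃ (N : ℕ) (e : Fin m × Fin N ↪ Fin n), 0 < N ∧
      ∀ (r : ℕ) (P : (Fin m → Fin N) → Matrix (Fin r) (Fin r) ℝ)
        (Q : Cube n → Matrix (Fin r) (Fin r) ℝ),
        (r : ℝ) ≤ α * ((n : ℝ) / Real.log (n : ℝ)) ^ ((d : ℝ) / 4) →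
        (∀ σ, (P σ).PosSemidef) → (∀ x, (Q x).PosSemidef) → (∀ σ x, (P σ * Q x).trace ≤ C) →
        -(ε * 2 ^ n * (N : ℝ) ^ m) <
          ∑ x, ∑ σ, D (fun i => x (blockEmbedding e σ i)) * (P σ * Q x).trace := by
  obtain ⟨c, γ, hc, hγ, hmain⟩ := exists_rate_sum_trace_mul_gt hD hC0 hε
  set Λ : ℝ := c * (2 + d) + 2 with hΛ
  have hΛpos : 0 < Λ := by positivity
  set Λ' : ℝ := Λ * m * (2 * (m + 1)) with hΛ'
  have hΛ'0 : 0 ≤ Λ' := by positivity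
  refine ⟨min 1 (γ / (Λ' ^ (d / 2 + 1) + 1)), by positivity, fun n hmn hn => ?_⟩
  have hn2 : (2 : ℝ) ≤ n := by exact_mod_cast hn
  have hnpos : (0 : ℝ) < n := by linarith
  have hlog2 : 1 / 2 ≤ Real.log n :=
    (by linarith [Real.log_two_gt_d9] : (1 : ℝ) / 2 ≤ Real.log 2).trans
      (Real.log_le_log (by norm_num) hn2)
  have hlogpos : 0 < Real.log n := by linarith
  -- The block length is n / m; using m + 1 in the last bound also covers m = 0, where any positive
  -- length fits.
  obtain ⟨N, hN, hmN, hNn⟩ : ∃ N : ℕ, 0 < N ∧ m * N ≤ n ∧ n ≤ 2 * (m + 1) * N := by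
    rcases Nat.eq_zero_or_pos m with rfl | hm
    · exact ⟨n, by omega, by omega, by omega⟩
    · refine ⟨n / m, Nat.div_pos hmn hm, Nat.mul_div_le n m, ?_⟩
      have h1 := Nat.lt_mul_div_succ n hm
      have h2 : 1 ≤ n / m := Nat.div_pos hmn hm
      nlinarith
  have hNpos : (0 : ℝ) < N := by exact_mod_cast hN
  refine ⟨N, finProdFinEquiv.toEmbedding.trans (Fin.castLEEmb hmN), hN,
    fun r P Q hr hP hQ hC => ?_⟩
  rcases Nat.eq_zero_or_pos r with rfl | hr0
  · simp only [Matrix.trace, Finset.univ_eq_empty, Finset.sum_empty, mul_zero,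
      Finset.sum_const_zero]
    rw [neg_lt_zero]
    positivity
  have hr1 : (1 : ℝ) ≤ r := by exact_mod_cast hr0
  set q : ℝ := n / Real.log n with hq
  have hq1 : 1 ≤ q := by
    rw [hq, one_le_div hlogpos]
    linarith [Real.log_le_sub_one_of_pos hnpos]
  have hqn : q ≤ n ^ 2 := by
    rw [hq, div_le_iff₀ hlogpos]
    nlinarith
  have hrq : (r : ℝ) ≤ q ^ ((d : ℝ) / 4) := by
    refine hr.trans ?_
    exact mul_le_of_le_one_left (by positivity) (min_le_left _ _)
  -- The size bound makes r polynomial in n, so k = O(log n) and km/N = O(log n / n).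
  have hlogr : Real.log r ≤ d / 2 * Real.log n := by
    have h1 := Real.log_le_log (by linarith) hrq
    rw [Real.log_rpow (by linarith)] at h1
    have h2 := Real.log_le_log (by linarith) hqn
    rw [Real.log_pow] at h2
    push_cast at h2
    nlinarith [mul_le_mul_of_nonneg_left h2 (by positivity : (0 : ℝ) ≤ d / 4)]
  set k : ℕ := ⌈c * (1 + Real.log r)⌉₊ with hk
  have hkle : (k : ℝ) ≤ Λ * Real.log n := by
    have h1 : (k : ℝ) < c * (1 + Real.log r) + 1 :=
      Nat.ceil_lt_add_one (mul_nonneg hc.le (by linarith [Real.log_nonneg hr1]))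
    have h2 : c * Real.log r ≤ c * (d / 2 * Real.log n) := mul_le_mul_of_nonneg_left hlogr hc.le
    have h3 : c * 1 ≤ c * (2 * Real.log n) := mul_le_mul_of_nonneg_left (by linarith) hc.le
    have h4 : 0 ≤ c * d * Real.log n := by positivity
    rw [hΛ]
    linarith
  refine hmain n N r k _ P Q hN hr0 hP hQ hC (Nat.le_ceil _) ?_
  have hfrac : ((k * m : ℕ) / N : ℝ) ≤ Λ' / q := by
    have h1 : (n : ℝ) ≤ 2 * (m + 1) * N := by exact_mod_cast hNn
    rw [hq, div_le_iff₀ hNpos, div_div_eq_mul_div, div_mul_eq_mul_div, le_div_iff₀ hnpos]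
    push_cast
    calc (k : ℝ) * m * n ≤ Λ * Real.log n * m * (2 * (m + 1) * N) := by gcongr
      _ = _ := by rw [hΛ']; ring
  -- The exponent d/4 leaves room: cancelling the power of Λ'/q only needs r = O(q^(d/2+1)), with
  -- natural-number division.
  have hrpow : q ^ ((d : ℝ) / 4) ≤ q ^ (d / 2 + 1) := by
    rw [← Real.rpow_natCast q (d / 2 + 1)]
    refine Real.rpow_le_rpow_of_exponent_le hq1 ?_
    have h1 : d ≤ 2 * (d / 2 + 1) := by omega
    have h2 : (d : ℝ) ≤ 2 * ((d / 2 + 1 : ℕ) : ℝ) := by exact_mod_cast h1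
    linarith [(Nat.cast_nonneg d : (0 : ℝ) ≤ d)]
  have hα0 : 0 ≤ γ / (Λ' ^ (d / 2 + 1) + 1) := by positivity
  calc (r : ℝ) * ((k * m : ℕ) / N : ℝ) ^ (d / 2 + 1)
      ≤ (γ / (Λ' ^ (d / 2 + 1) + 1) * q ^ (d / 2 + 1)) * (Λ' / q) ^ (d / 2 + 1) := by
        refine mul_le_mul (hr.trans (mul_le_mul (min_le_right _ _) hrpow (by positivity) hα0))
          (pow_le_pow_left₀ (by positivity) hfrac _) (by positivity) (by positivity)
    _ = γ / (Λ' ^ (d / 2 + 1) + 1) * Λ' ^ (d / 2 + 1) := by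
        have hcancel : q * (Λ' / q) = Λ' := by
          clear_value q
          field_simp
        rw [mul_assoc, ← mul_pow, hcancel]
    _ ≤ γ := by
        rw [div_mul_eq_mul_div, div_le_iff₀ (by positivity)]
        nlinarith

/-! ### Instances on more variables -/

namespace CSPInstance

variable {k : ℕ} {Preds : Finset ((Fin k → Bool) → Bool)} {m n : ℕ}

/-- The copy of an instance on the variables in the range of `σ`. -/
def embed (I : CSPInstance Preds m) (σ : Fin m ↪ Fin n) : CSPInstance Preds n where
  size := I.size
  size_pos := I.size_pos
  constraint j :=
    { pred := (I.constraint j).pred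
      pred_mem := (I.constraint j).pred_mem
      index := (I.constraint j).index.trans σ }

theorem value_embed (I : CSPInstance Preds m) (σ : Fin m ↪ Fin n) (x : Cube n) :
    (I.embed σ).value x = I.value fun i => x (σ i) := rfl

theorem value_le_opt (I : CSPInstance Preds n) (x : Cube n) : I.value x ≤ I.opt :=
  Finset.le_sup' I.value (Finset.mem_univ x)

theorem opt_embed_le (I : CSPInstance Preds m) (σ : Fin m ↪ Fin n) : (I.embed σ).opt ≤ I.opt :=
  Finset.sup'_le _ _ fun x _ => by
    rw [value_embed]
    exact I.value_le_opt _

theorem value_nonneg (I : CSPInstance Preds n) (x : Cube n) : 0 ≤ I.value x :=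
  div_nonneg (Finset.sum_nonneg fun _ _ => by split_ifs <;> norm_num) (Nat.cast_nonneg _)

/-- The functions `c - I(x_σ)`, for all embeddings `σ`, agree up to arbitrarily small errors with
nonnegative constants plus the inner products of `Q` with positive semidefinite matrices. -/
def ApproxFactors (I : CSPInstance Preds m) (c : ℝ) {r : ℕ}
    (Q : Cube n → Matrix (Fin r) (Fin r) ℝ) : Prop :=
  ∀ (σ : Fin m ↪ Fin n) (η : ℝ), 0 < η → ∃ (P : Matrix (Fin r) (Fin r) ℝ) (b : ℝ),
    P.PosSemidef ∧ 0 ≤ b ∧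
      ∀ x, |(c - I.value fun i => x (σ i)) - (b + (P * Q x).trace)| ≤ η

theorem not_approxFactors_of_lt (I : CSPInstance Preds m) {c : ℝ} {y : Cube m} (hy : c < I.value y)
    (hmn : m ≤ n) {r : ℕ} {Q : Cube n → Matrix (Fin r) (Fin r) ℝ} (hQ : ∀ x, (Q x).PosSemidef) :
    ¬ I.ApproxFactors c Q := by
  intro h
  set σ := Fin.castLEEmb hmn
  obtain ⟨P, b, hP, hb, happ⟩ := h σ ((I.value y - c) / 2) (by linarith)
  have h1 := (abs_le.mp (happ (Function.extend σ y fun _ => false))).1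
  have h2 : (fun i => Function.extend σ y (fun _ => false) (σ i)) = y :=
    funext fun i => σ.injective.extend_apply _ _ _
  rw [h2] at h1
  have h3 := hP.trace_mul_nonneg (hQ (Function.extend σ y fun _ => false))
  linarith

/-- Pairing the factorizations with D(x_σ) contradicts the lower bound. The constants `b σ` may be
dropped, since ∑ D ≥ 0 follows from 1 = 1². -/
theorem exists_dimension_bound_not_approxFactors (I : CSPInstance Preds m) {c : ℝ} {d : ℕ} {ε : ℝ}
    (hε : 0 < ε) (hI : ¬ IsSumSqOf (sosSubspace m d) fun x => (c - I.value x) + ε) :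
    ∃ α : ℝ, 0 < α ∧ ∀ n : ℕ, m ≤ n → 2 ≤ n → ∀ (r : ℕ) (Q : Cube n → Matrix (Fin r) (Fin r) ℝ),
      (∀ x, (Q x).PosSemidef) → (r : ℝ) ≤ α * ((n : ℝ) / Real.log (n : ℝ)) ^ ((d : ℝ) / 4) →
      ¬ I.ApproxFactors c Q := by
  obtain ⟨D, hD, hneg⟩ := exists_pseudoDensity hε hI
  set ε₀ : ℝ := -(∑ y, D y * (c - I.value y)) / 2 ^ m with hε₀
  have hε₀pos : 0 < ε₀ := div_pos (by linarith) (by positivity)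
  have hB0 : 0 ≤ ∑ y, |D y| := Finset.sum_nonneg fun _ _ => abs_nonneg _
  set B : ℝ := ∑ y, |D y| with hBdef
  have hB : ∀ y, |D y| ≤ B := fun y =>
    Finset.single_le_sum (f := fun y => |D y|) (fun _ _ => abs_nonneg _) (Finset.mem_univ y)
  have hDsum : 0 ≤ ∑ y, D y := by
    have := hD _ (const_mem_sosSubspace 1)
    simpa using this
  obtain ⟨α, hα, hmain⟩ := exists_dimension_bound_sum_trace_mul_gt hD
    (C := |c| + 1) (ε := ε₀ / 2) (by positivity) (by positivity)
  refine ⟨α, hα, fun n hmn hn r Q hQ hr h => ?_⟩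
  obtain ⟨N, e, hN, hlow⟩ := hmain n hmn hn
  -- The bound by 1 keeps all Tr(P_σ Q(x)) below |c| + 1; the other keeps the error weighted by `D`
  -- below half of the gap ε₀.
  set η : ℝ := min 1 (ε₀ / (2 * (B + 1))) with hη
  have hηpos : 0 < η := by positivity
  have hBη : B * η ≤ ε₀ / 2 := by
    have h1 : η ≤ ε₀ / (2 * (B + 1)) := min_le_right _ _
    rw [le_div_iff₀ (by positivity)] at h1
    linarith
  choose P b hP hb happ using fun σ : Fin m → Fin N => h (blockEmbedding e σ) η hηpos
  have hlt := hlow r P Q hr hP hQ fun σ x => by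
    have h1 := (abs_le.mp (happ σ x)).1
    have h2 := I.value_nonneg fun i => x (blockEmbedding e σ i)
    have h3 : η ≤ 1 := min_le_left _ _
    linarith [le_abs_self c, hb σ]
  have hpow : (2 : ℝ) ^ m ≠ 0 := by positivity
  have hpush : ∀ (σ : Fin m ↪ Fin n) (F : Cube m → ℝ),
      ∑ x : Cube n, F (fun i => x (σ i)) = 2 ^ n * ((∑ y, F y) / 2 ^ m) := by
    intro σ F
    have := sum_comp_embedding σ F
    field_simp
    linarith
  have hσ : ∀ σ ∈ (Finset.univ : Finset (Fin m → Fin N)),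
      ∑ x, D (fun i => x (blockEmbedding e σ i)) * (P σ * Q x).trace ≤ -(ε₀ / 2 * 2 ^ n) := by
    intro σ _
    have h1 : ∀ x ∈ (Finset.univ : Finset (Cube n)),
        D (fun i => x (blockEmbedding e σ i)) * (P σ * Q x).trace ≤
          (D (fun i => x (blockEmbedding e σ i)) *
            (c - I.value fun i => x (blockEmbedding e σ i)) -
            b σ * D fun i => x (blockEmbedding e σ i)) + ε₀ / 2 := by
      intro x _
      have h2 := abs_mul (D fun i => x (blockEmbedding e σ i))
        ((c - I.value fun i => x (blockEmbedding e σ i)) - (b σ + (P σ * Q x).trace))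
      have h3 := mul_le_mul (hB fun i => x (blockEmbedding e σ i)) (happ σ x) (abs_nonneg _) hB0
      rw [← h2] at h3
      have h4 := (abs_le.mp (h3.trans hBη)).1
      linarith
    refine (Finset.sum_le_sum h1).trans ?_
    rw [Finset.sum_add_distrib, Finset.sum_sub_distrib, ← Finset.mul_sum,
      hpush (blockEmbedding e σ) fun y => D y * (c - I.value y), hpush (blockEmbedding e σ) D,
      Finset.sum_const, Finset.card_univ, Fintype.card_fun, Fintype.card_bool, Fintype.card_fin,
      nsmul_eq_mul]
    push_cast
    have h5 : (∑ y, D y * (c - I.value y)) / 2 ^ m = -ε₀ := by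
      rw [hε₀]
      ring
    have h6 : 0 ≤ b σ * (2 ^ n * ((∑ y, D y) / 2 ^ m)) :=
      mul_nonneg (hb σ) (mul_nonneg (by positivity) (div_nonneg hDsum (by positivity)))
    rw [h5]
    linarith
  have hle := Finset.sum_le_card_nsmul _ _ _ hσ
  rw [Finset.card_univ, Fintype.card_fun, Fintype.card_fin, Fintype.card_fin, nsmul_eq_mul,
    Finset.sum_comm] at hle
  push_cast at hle
  linarith

end CSPInstance

/-! ### Factorizations from approximations -/

theorem sosUpperBound_le_of_isSumSqOf {n : ℕ} {U : Submodule ℝ (Cube n → ℝ)} {f : Cube n → ℝ}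
    {a : ℝ} (h : IsSumSqOf U fun x => a - f x) : sosUpperBound U f ≤ a :=
  sInf_le ⟨a, rfl, h⟩

theorem exists_isSumSqOf_of_sosUpperBound_le {n : ℕ} {U : Submodule ℝ (Cube n → ℝ)}
    {f : Cube n → ℝ} {c η : ℝ} (h : sosUpperBound U f ≤ (c : EReal)) (hη : 0 < η) :
    ∃ a, a < c + η ∧ IsSumSqOf U fun x => a - f x := by
  have hlt : sosUpperBound U f < ((c + η : ℝ) : EReal) :=
    lt_of_le_of_lt h (EReal.coe_lt_coe_iff.mpr (by linarith))
  obtain ⟨_, ⟨a, rfl, ha⟩, hac⟩ := sInf_lt_iff.mp hlt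
  exact ⟨a, EReal.coe_lt_coe_iff.mp hac, ha⟩

theorem exists_not_isSumSqOf_of_lt_sosUpperBound {n : ℕ} {U : Submodule ℝ (Cube n → ℝ)}
    {f : Cube n → ℝ} {c : ℝ} (h : (c : EReal) < sosUpperBound U f) :
    ∃ ε, 0 < ε ∧ ¬ IsSumSqOf U fun x => (c - f x) + ε := by
  obtain ⟨a, hca, ha⟩ := EReal.lt_iff_exists_real_btwn.mp h
  rw [EReal.coe_lt_coe_iff] at hca
  refine ⟨a - c, by linarith, fun hs => ?_⟩
  have : (fun x => (c - f x) + (a - c)) = fun x => a - f x := by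
    ext x
    ring
  rw [this] at hs
  exact not_lt.mpr (sosUpperBound_le_of_isSumSqOf hs) ha

theorem Matrix.trace_vecMulVec_mul_vecMulVec {r : ℕ} (v w : Fin r → ℝ) :
    (vecMulVec v v * vecMulVec w w).trace = (v ⬝ᵥ w) ^ 2 := by
  rw [vecMulVec_mul_vecMulVec, trace_vecMulVec, dotProduct_smul, smul_eq_mul, sq]

/-- Let v(x) be the vector of values at x of a basis of `U`. A square of an element of `U` is a
squared inner product with v(x), hence the pairing of a rank-one psd matrix with Q(x) = v(x) v(x)ᵀ.
-/
theorem SubspaceAchieves.exists_approxFactors {k : ℕ} {Preds : Finset ((Fin k → Bool) → Bool)}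
    {m n : ℕ} {U : Submodule ℝ (Cube n → ℝ)} {c s : ℝ} (hU : SubspaceAchieves Preds U c s)
    {I : CSPInstance Preds m} (hI : I.opt ≤ s) :
    ∃ Q : Cube n → Matrix (Fin (Module.finrank ℝ U)) (Fin (Module.finrank ℝ U)) ℝ,
      (∀ x, (Q x).PosSemidef) ∧ I.ApproxFactors c Q := by
  set β := Module.finBasis ℝ U
  refine ⟨fun x => Matrix.vecMulVec (fun i => (β i : Cube n → ℝ) x) fun i => (β i : Cube n → ℝ) x,
    fun x => by simpa using Matrix.posSemidef_vecMulVec_self_star fun i => (β i : Cube n → ℝ) x,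
    fun σ η hη => ?_⟩
  obtain ⟨a, hac, t, g, hg, hsum⟩ := exists_isSumSqOf_of_sosUpperBound_le
    (hU (I.embed σ) ((I.opt_embed_le σ).trans hI)) hη
  set v : Fin t → Fin (Module.finrank ℝ U) → ℝ := fun j i => β.repr ⟨g j, hg j⟩ i
  have hv : ∀ j x, v j ⬝ᵥ (fun i => (β i : Cube n → ℝ) x) = g j x := by
    intro j x
    have h1 := congrArg (fun u : U => (u : Cube n → ℝ) x) (β.sum_repr ⟨g j, hg j⟩)
    simp only [Submodule.coe_sum, Submodule.coe_smul, Finset.sum_apply, Pi.smul_apply,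
      smul_eq_mul] at h1
    exact h1
  refine ⟨∑ j, Matrix.vecMulVec (v j) (v j), max (c - a) 0,
    Matrix.posSemidef_sum _ fun j _ => by
      simpa using Matrix.posSemidef_vecMulVec_self_star (v j), le_max_right _ _, fun x => ?_⟩
  rw [Finset.sum_mul, Matrix.trace_sum]
  simp only [Matrix.trace_vecMulVec_mul_vecMulVec, hv]
  rw [← hsum x, abs_le]
  simp only [CSPInstance.value_embed]
  rcases max_cases (c - a) 0 with ⟨h1, h2⟩ | ⟨h1, h2⟩ <;> rw [h1] <;> constructor <;> linarith

/-! ### Factorizations from SDP relaxations by conic duality. -/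

namespace SDPRelaxation

variable {k : ℕ} {Preds : Finset ((Fin k → Bool) → Bool)} {n r : ℕ}

/-- The weights may be negative: an affine combination of the points stays in the affine subspace,
and positivity is demanded only of the resulting matrix. -/
theorem Achieves.sum_mul_value_le {R : SDPRelaxation Preds n r} {c s : ℝ} (hR : R.Achieves c s)
    {I : CSPInstance Preds n} (hI : I.opt ≤ s) {w : Cube n → ℝ} (hw : ∑ x, w x = 1)
    (hpsd : (∑ x, w x • R.linPoint x).PosSemidef) : ∑ x, w x * I.value x ≤ c := by
  have hmem : ∑ x, w x • R.linPoint x ∈ R.affine := by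
    have h1 := affineCombination_mem_affineSpan hw R.linPoint
    rw [Finset.affineCombination_eq_linear_combination _ _ _ hw] at h1
    refine affineSpan_le.mpr ?_ h1
    rintro _ ⟨x, rfl⟩
    exact R.point_affine x
  have h2 := (le_iSup₂ (f := fun Y (_ : Y ∈ R.feasible) =>
    (matrixInner (R.linInstance I) Y : EReal)) _ (⟨hmem, hpsd⟩ : _ ∈ R.feasible)).trans (hR I hI)
  rw [EReal.coe_le_coe_iff] at h2
  refine le_trans (le_of_eq ?_) h2
  unfold matrixInner
  rw [Finset.mul_sum, Matrix.trace_sum]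
  refine Finset.sum_congr rfl fun x _ => ?_
  rw [Matrix.mul_smul, Matrix.trace_smul, smul_eq_mul, ← R.inner_eq I x, matrixInner]

/-- Otherwise a separating functional μ exists. Testing it on rank-one P shows that ∑ μ(x) x̃ is
psd, testing it on constants that ∑ μ ≥ 0; normalized, μ yields a feasible matrix of value above
`c`. Asking only for the closure avoids any constraint qualification. -/
theorem Achieves.mem_closure {R : SDPRelaxation Preds n r} {c s : ℝ} (hR : R.Achieves c s)
    {I : CSPInstance Preds n} (hI : I.opt ≤ s) :
    (fun x => c - I.value x) ∈ closure {p : Cube n → ℝ | ∃ (P : Matrix (Fin r) (Fin r) ℝ) (b : ℝ),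
      P.PosSemidef ∧ 0 ≤ b ∧ ∀ x, p x = b + (P * R.linPoint x).trace} := by
  by_contra hcon
  set K := {p : Cube n → ℝ | ∃ (P : Matrix (Fin r) (Fin r) ℝ) (b : ℝ),
    P.PosSemidef ∧ 0 ≤ b ∧ ∀ x, p x = b + (P * R.linPoint x).trace}
  have h0 : (0 : Cube n → ℝ) ∈ K := ⟨0, 0, Matrix.PosSemidef.zero, le_rfl, fun x => by simp⟩
  have hadd : ∀ p ∈ K, ∀ q ∈ K, p + q ∈ K := by
    rintro p ⟨P, b, hP, hb, hp⟩ q ⟨P', b', hP', hb', hq⟩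
    refine ⟨P + P', b + b', hP.add hP', add_nonneg hb hb', fun x => ?_⟩
    rw [Pi.add_apply, hp, hq, add_mul, Matrix.trace_add]
    ring
  have hsmul : ∀ a : ℝ, 0 ≤ a → ∀ p ∈ K, a • p ∈ K := by
    rintro a ha p ⟨P, b, hP, hb, hp⟩
    refine ⟨a • P, a * b, hP.smul ha, mul_nonneg ha hb, fun x => ?_⟩
    rw [Pi.smul_apply, hp, Matrix.smul_mul, Matrix.trace_smul, smul_eq_mul, smul_eq_mul]
    ring
  obtain ⟨μ, hμ, hneg⟩ := exists_separating_weights h0 hadd hsmul hcon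
  have hsum : 0 ≤ ∑ x, μ x := by
    have := hμ (fun _ => 1) ⟨0, 1, Matrix.PosSemidef.zero, zero_le_one, fun x => by simp⟩
    simpa using this
  have hpsd : (∑ x, μ x • R.linPoint x).PosSemidef := by
    refine .of_dotProduct_mulVec_nonneg ?_ fun v => ?_
    · rw [Matrix.IsHermitian, Matrix.conjTranspose_sum]
      refine Finset.sum_congr rfl fun x _ => ?_
      rw [Matrix.conjTranspose_smul, (R.point_psd x).1.eq, star_trivial]
    · have h1 := hμ (fun x => (Matrix.vecMulVec v v * R.linPoint x).trace)
        ⟨Matrix.vecMulVec v v, 0, by simpa using Matrix.posSemidef_vecMulVec_self_star v, le_rfl,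
          fun x => by simp⟩
      refine h1.trans_eq ?_
      rw [star_trivial, Matrix.sum_mulVec, dotProduct_sum]
      refine Finset.sum_congr rfl fun x _ => ?_
      rw [Matrix.smul_mulVec, dotProduct_smul, smul_eq_mul, Matrix.trace_mul_comm,
        Matrix.mul_vecMulVec, Matrix.trace_vecMulVec, dotProduct_comm]
  obtain ⟨x₀⟩ : Nonempty (Cube n) := inferInstance
  -- The total mass of μ may vanish; a small extra mass τ at `x₀` allows normalization and keeps the
  -- strict inequality.
  obtain ⟨τ, hτ, hsmall⟩ : ∃ τ : ℝ, 0 < τ ∧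
      ∑ x, μ x * (c - I.value x) + τ * (c - I.value x₀) < 0 := by
    refine ⟨-(∑ x, μ x * (c - I.value x)) / (2 * (|c - I.value x₀| + 1)),
      div_pos (by linarith) (by positivity), ?_⟩
    have h1 : 0 < -(∑ x, μ x * (c - I.value x)) / (2 * (|c - I.value x₀| + 1)) :=
      div_pos (by linarith) (by positivity)
    have h2 := mul_le_mul_of_nonneg_left (le_abs_self (c - I.value x₀)) h1.le
    have h3 : -(∑ x, μ x * (c - I.value x)) / (2 * (|c - I.value x₀| + 1)) *
        (2 * (|c - I.value x₀| + 1)) = -(∑ x, μ x * (c - I.value x)) :=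
      div_mul_cancel₀ _ (by positivity)
    linarith
  have hS : 0 < ∑ x, μ x + τ := by linarith
  set w : Cube n → ℝ := fun x => (μ x + if x = x₀ then τ else 0) / (∑ x, μ x + τ) with hw
  have hform : ∀ F : Cube n → ℝ,
      ∑ x, w x * F x = (∑ x, μ x * F x + τ * F x₀) / (∑ x, μ x + τ) := by
    intro F
    simp only [hw, div_mul_eq_mul_div]
    rw [← Finset.sum_div]
    congr 1
    simp [add_mul, Finset.sum_add_distrib]
  have h1 := hR.sum_mul_value_le hI (w := w) ?_ ?_
  · rw [hform, div_le_iff₀ hS] at h1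
    simp only [mul_sub, Finset.sum_sub_distrib, ← Finset.sum_mul] at hsmall
    linarith
  · have := hform fun _ => 1
    simpa only [mul_one, div_self hS.ne'] using this
  · have h2 : ∑ x, w x • R.linPoint x = (1 / (∑ x, μ x + τ)) •
        (∑ x, μ x • R.linPoint x + τ • R.linPoint x₀) := by
      simp only [hw, div_eq_inv_mul, mul_one, ← smul_smul, ← Finset.smul_sum, add_smul,
        Finset.sum_add_distrib, ite_smul, zero_smul, Finset.sum_ite_eq', Finset.mem_univ, if_true]
    rw [h2]
    exact (hpsd.add ((R.point_psd x₀).smul hτ.le)).smul (by positivity)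

theorem Achieves.approxFactors {m : ℕ} {R : SDPRelaxation Preds n r} {c s : ℝ}
    (hR : R.Achieves c s) {I : CSPInstance Preds m} (hI : I.opt ≤ s) :
    I.ApproxFactors c R.linPoint := by
  intro σ η hη
  obtain ⟨p, ⟨P, b, hP, hb, hp⟩, hdist⟩ := Metric.mem_closure_iff.mp
    (hR.mem_closure ((I.opt_embed_le σ).trans hI)) η hη
  refine ⟨P, b, hP, hb, fun x => ?_⟩
  rw [← hp x, ← CSPInstance.value_embed]
  exact (dist_le_pi_dist _ p x).trans hdist.le

end SDPRelaxation

theorem mainTheorem4 {k : ℕ} (Preds : Finset ((Fin k → Bool) → Bool)) (m : ℕ) (c s : ℝ) :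
    ∃ α : ℝ, 0 < α ∧
      ∀ d : ℕ, ¬ SubspaceAchieves Preds (sosSubspace m d) c s →
        ∀ n : ℕ, m ≤ n → 2 ≤ n →
          (∀ U : Submodule ℝ (Cube n → ℝ),
            (Module.finrank ℝ U : ℝ) ≤ α * ((n : ℝ) / Real.log (n : ℝ)) ^ ((d : ℝ) / 4) →
              ¬ SubspaceAchieves Preds U c s) ∧
          (∀ (r : ℕ) (R : SDPRelaxation Preds n r),
            (r : ℝ) ≤ α * ((n : ℝ) / Real.log (n : ℝ)) ^ ((d : ℝ) / 4) →
              ¬ R.Achieves c s) := by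
  have hfail : ∀ d, ¬ SubspaceAchieves Preds (sosSubspace m d) c s →
      ∃ I : CSPInstance Preds m, I.opt ≤ s ∧ ∃ ε, 0 < ε ∧
        ¬ IsSumSqOf (sosSubspace m d) fun x => (c - I.value x) + ε := by
    intro d hd
    simp only [SubspaceAchieves, not_forall, not_le] at hd
    obtain ⟨I, hI, hlt⟩ := hd
    exact ⟨I, hI, exists_not_isSumSqOf_of_lt_sosUpperBound hlt⟩
  have hbound : ∀ d, ∃ α : ℝ, 0 < α ∧ (¬ SubspaceAchieves Preds (sosSubspace m d) c s →
      ∃ I : CSPInstance Preds m, I.opt ≤ s ∧ ∀ n : ℕ, m ≤ n → 2 ≤ n →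
        ∀ (r : ℕ) (Q : Cube n → Matrix (Fin r) (Fin r) ℝ), (∀ x, (Q x).PosSemidef) →
        (r : ℝ) ≤ α * ((n : ℝ) / Real.log (n : ℝ)) ^ ((d : ℝ) / 4) → ¬ I.ApproxFactors c Q) := by
    intro d
    by_cases hd : SubspaceAchieves Preds (sosSubspace m d) c s
    · exact ⟨1, one_pos, fun h => absurd hd h⟩
    · obtain ⟨I, hI, ε, hε, hns⟩ := hfail d hd
      obtain ⟨α, hα, h⟩ := I.exists_dimension_bound_not_approxFactors hε hns
      exact ⟨α, hα, fun _ => ⟨I, hI, h⟩⟩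
  choose α hα hmain using hbound
  -- Only the finitely many d ≤ 2m constrain α, so a minimum over them is positive.
  have hne : (Finset.range (2 * m + 1)).Nonempty := ⟨0, by simp⟩
  refine ⟨(Finset.range (2 * m + 1)).inf' hne α, (Finset.lt_inf'_iff hne).mpr fun d _ => hα d,
    fun d hd n hmn hn => ?_⟩
  obtain ⟨I, hI, hno⟩ : ∃ I : CSPInstance Preds m, I.opt ≤ s ∧
      ∀ (r : ℕ) (Q : Cube n → Matrix (Fin r) (Fin r) ℝ), (∀ x, (Q x).PosSemidef) →
      (r : ℝ) ≤ (Finset.range (2 * m + 1)).inf' hne α *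
        ((n : ℝ) / Real.log (n : ℝ)) ^ ((d : ℝ) / 4) → ¬ I.ApproxFactors c Q := by
    by_cases hdm : d < 2 * m + 1
    · obtain ⟨I, hI, h⟩ := hmain d hd
      refine ⟨I, hI, fun r Q hQ hr => h n hmn hn r Q hQ (hr.trans ?_)⟩
      have hlog : 0 ≤ Real.log (n : ℝ) := Real.log_natCast_nonneg n
      exact mul_le_mul_of_nonneg_right (Finset.inf'_le α (Finset.mem_range.mpr hdm))
        (by positivity)
    · obtain ⟨I, hI, ε, hε, hns⟩ := hfail d hd
      -- For d > 2m the certificate space is everything: were c - I nonnegative, c - I + ε would be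
      -- the square of its square root.
      obtain ⟨y, hy⟩ : ∃ y, c < I.value y := by
        by_contra! hle
        refine hns ?_
        rw [sosSubspace_eq_top (by omega)]
        convert isSumSqOf_sq (U := (⊤ : Submodule ℝ (Cube m → ℝ)))
          (g := fun x => Real.sqrt ((c - I.value x) + ε)) trivial using 1
        ext x
        rw [Real.sq_sqrt (by linarith [hle x])]
      exact ⟨I, hI, fun r Q hQ _ => I.not_approxFactors_of_lt hy hmn hQ⟩
  refine ⟨fun U hU hach => ?_, fun r R hr hach =>
    hno r R.linPoint R.point_psd hr (hach.approxFactors hI)⟩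
  obtain ⟨Q, hQ, happ⟩ := hach.exists_approxFactors hI
  exact hno _ Q hQ hU happ
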